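/- Let $\Gamma$ be a metric graph, that is, the geometric realization of a finite connected multigraph (loops and multiple edges allowed) whose edges have positive real lengths, and let $g=\dim H_1(\Gamma,\mathbb R)$ be its genus. A divisor is an element of the free abelian group on the points of $\Gamma$. It is effective if all its coefficients are nonnegative. Two divisors are linearly equivalent ($D\sim D'$) if $D-D'=\operatorname{div}(\phi)$ for a continuous piecewise affine function $\phi\colon\Gamma\to\mathbb R$ with integer slopes, where the coefficient of $\operatorname{div}(\phi)$ at $p$ is the sum of the incoming slopes of $\phi$ at $p$. Write $|D|$ for the set of effective divisors linearly equivalent to $D$. The rank $r(D)$ is $-1$ if $|D|=\emptyset$; otherwise it is the largest integer $s\ge 0$ such that $|D-E|\neq\emptyset$ for all effective divisors $E$ of degree $s$. For an integer $d\ge 0$ let $\operatorname{Pic}^d(\Gamma)$ be the set of linear equivalence classes of divisors of degree $d$, with the topology inherited, via the Abel–Jacobi map $\Phi_q^{(d)}$ with any base point $q\in\Gamma$, from the tropical Jacobian $\operatorname{Jac}(\Gamma)=H_1(\Gamma,\mathbb R)/H_1(\Gamma,\mathbb Z)$. Here $\Phi_q$ sends $p$ to the class of the functional $\omega\mapsto\int_q^p\omega$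 on harmonic $1$-forms, which are identified with $H_1(\Gamma,\mathbb R)$, as are the functionals on them by means of the length pairing; and $\Phi_q^{(d)}$ is the additive extension of $\Phi_q$ to divisors of degree $d$. Let $W_d\subseteq\operatorname{Pic}^d(\Gamma)$ be the set of classes of effective divisors of degree $d$, with the subspace topology. Then for every integer $d\ge 0$ there exists an open dense subset $U_d\subseteq W_d$ such that, for every divisor $D$ of degree $d$ with $[D]\in U_d$, $$r(D)=\begin{cases} d-g & \text{if } d>g,\\ 0 & \text{if } 0\le d\le g.\end{cases}$$ -/

import Mathlib

open Set Filter Topology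

/-- A model of a metric graph: a finite connected multigraph (loops and multiple edges are
allowed) with edge set `E`, vertex set `V`, an auxiliary orientation of each edge, and a positive
real length on each edge.  The metric graph itself is the geometric realization, in which the
edge `e` is the segment `[0, len e]` glued to its two end vertices; its points are
`MetricGraph.Point`. -/
structure MetricGraph (V E : Type*) where
  src : E → V
  tgt : E → V
  len : E → ℝ
  len_pos : ∀ e, 0 < len e
  nonempty : Nonempty V
  connected : ∀ u v : V, Relation.EqvGen (fun a b => ∃ e, src e = a ∧ tgt e = b) u v

namespace MetricGraph

noncomputable section

/-- The points of the geometric realization: the vertices, and the interior points of the edges;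
`inner e t _ _` is the point of the edge `e` at distance `t` (along `e`) from `src e`. -/
inductive Point {V E : Type*} (Γ : MetricGraph V E) where
  | vertex (v : V) : Point Γ
  | inner (e : E) (t : ℝ) (h0 : 0 < t) (h1 : t < Γ.len e) : Point Γ

variable {V E : Type*} (Γ : MetricGraph V E)

/-- The parametrization `[0, len e] → Γ` of a closed edge by arc length (extended to `ℝ` by the
endpoints). -/
def edgePoint (e : E) (t : ℝ) : Γ.Point :=
  if h0 : 0 < t then
    if h1 : t < Γ.len e then .inner e t h0 h1 else .vertex (Γ.tgt e)
  else .vertex (Γ.src e)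

/-! ### Rational functions and divisors -/

/-- `f` is piecewise linear with integral slopes on `[0, l]`: away from finitely many breakpoints
it is affine with integral slope.  As affineness is required on closed intervals whose interior
contains no breakpoint, such an `f` is continuous on `[0, l]`. -/
def IsIntegralPL (l : ℝ) (f : ℝ → ℝ) : Prop :=
  ∃ B : Finset ℝ, ∀ a b : ℝ, 0 ≤ a → a < b → b ≤ l → (∀ x ∈ B, x ∉ Ioo a b) →
    ∃ m : ℤ, ∀ t ∈ Icc a b, f t = f a + m * (t - a)

/-- The group `R(Γ)` of rational functions, as a predicate: the continuous piecewise affine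
functions with integral slopes on `Γ`. -/
def IsRational (φ : Γ.Point → ℝ) : Prop :=
  ∀ e, IsIntegralPL (Γ.len e) (fun t => φ (Γ.edgePoint e t))

/-- The slope of `φ` on the edge `e` at position `t`, in the direction of increasing `t`. -/
def slopeRight (φ : Γ.Point → ℝ) (e : E) (t : ℝ) : ℝ :=
  derivWithin (fun s => φ (Γ.edgePoint e s)) (Icc t (Γ.len e)) t

/-- The slope of `φ` on the edge `e` just before position `t`, still measured in the direction
of increasing `t`. -/
def slopeLeft (φ : Γ.Point → ℝ) (e : E) (t : ℝ) : ℝ :=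
  derivWithin (fun s => φ (Γ.edgePoint e s)) (Icc 0 t) t

/-- The coefficient `σ_p(φ)` of `div φ` at `p`: the sum of the incoming slopes of `φ` at `p`
over all directions at `p` (a loop contributes two directions at its vertex). -/
def ord [Fintype E] [DecidableEq V] (φ : Γ.Point → ℝ) : Γ.Point → ℝ
  | .vertex v =>
      (∑ e, if Γ.tgt e = v then Γ.slopeLeft φ e (Γ.len e) else 0)
        - ∑ e, if Γ.src e = v then Γ.slopeRight φ e 0 else 0
  | .inner e t _ _ => Γ.slopeLeft φ e t - Γ.slopeRight φ e t

/-- The group `Div(Γ)` of divisors: the free abelian group on the points of `Γ`. -/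
abbrev Divisor : Type _ := Γ.Point →₀ ℤ

variable {Γ}

/-- The degree of a divisor. -/
def Divisor.degree (D : Γ.Divisor) : ℤ := D.sum fun _ n => n

/-- A divisor is effective if all its coefficients are nonnegative. -/
def Divisor.IsEffective (D : Γ.Divisor) : Prop := ∀ p, 0 ≤ D p

/-- Linear equivalence: `D₁ - D₂ = div φ` for some rational function `φ`. -/
def Divisor.LinEquiv [Fintype E] [DecidableEq V] (D₁ D₂ : Γ.Divisor) : Prop :=
  ∃ φ : Γ.Point → ℝ, Γ.IsRational φ ∧ ∀ p, ((D₁ p - D₂ p : ℤ) : ℝ) = Γ.ord φ p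

/-- The complete linear system `|D|`: the effective divisors linearly equivalent to `D`. -/
def Divisor.linearSystem [Fintype E] [DecidableEq V] (D : Γ.Divisor) : Set Γ.Divisor :=
  {D' | D'.IsEffective ∧ D'.LinEquiv D}

/-- `D.HasRank r` says that the rank of `D` is `r`: the rank is at least `-1`, and it is at least
`s ≥ 0` exactly when `|D - E|` is nonempty for every effective divisor `E` of degree `s`. -/
def Divisor.HasRank [Fintype E] [DecidableEq V] (D : Γ.Divisor) (r : ℤ) : Prop :=
  IsGreatest {s : ℤ | s = -1 ∨ (0 ≤ s ∧ ∀ E' : Γ.Divisor, E'.IsEffective → E'.degree = s →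
    (D - E').linearSystem.Nonempty)} r

/-! ### Linear equivalence is an equivalence relation -/

theorem IsIntegralPL.zero (l : ℝ) : IsIntegralPL l (fun _ => 0) :=
  ⟨∅, fun _ _ _ _ _ _ => ⟨0, fun _ _ => by simp⟩⟩

theorem IsIntegralPL.neg {l : ℝ} {f : ℝ → ℝ} (hf : IsIntegralPL l f) :
    IsIntegralPL l (fun t => - f t) := by
  obtain ⟨B, hB⟩ := hf
  refine ⟨B, fun a b h0 hab hl hx => ?_⟩
  obtain ⟨m, hm⟩ := hB a b h0 hab hl hx
  exact ⟨-m, fun t ht => by simp only [hm t ht]; push_cast; ring⟩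

theorem IsIntegralPL.add {l : ℝ} {f g : ℝ → ℝ} (hf : IsIntegralPL l f) (hg : IsIntegralPL l g) :
    IsIntegralPL l (fun t => f t + g t) := by
  classical
  obtain ⟨B, hB⟩ := hf
  obtain ⟨C, hC⟩ := hg
  refine ⟨B ∪ C, fun a b h0 hab hl hx => ?_⟩
  obtain ⟨m, hm⟩ := hB a b h0 hab hl fun x h => hx x (Finset.mem_union_left _ h)
  obtain ⟨n, hn⟩ := hC a b h0 hab hl fun x h => hx x (Finset.mem_union_right _ h)
  exact ⟨m + n, fun t ht => by simp only [hm t ht, hn t ht]; push_cast; ring⟩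

theorem IsIntegralPL.differentiableRight {l : ℝ} {f : ℝ → ℝ} (hf : IsIntegralPL l f) {t : ℝ}
    (h0 : 0 ≤ t) (hl : t < l) : DifferentiableWithinAt ℝ f (Icc t l) t := by
  obtain ⟨B, hB⟩ := hf
  have hev : ∀ᶠ b in 𝓝[>] t, ∀ x ∈ B, x ∉ Ioo t b := by
    refine (Filter.eventually_all_finset B).2 fun x _ => ?_
    rcases le_or_gt x t with h | h
    · exact Eventually.of_forall fun b hb => absurd hb.1 (not_lt.2 h)
    · filter_upwards [Ioo_mem_nhdsGT h] with b hb hx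
      exact absurd hx.2 (not_lt.2 hb.2.le)
  obtain ⟨b, hb, hbt⟩ := (hev.and (Ioc_mem_nhdsGT hl)).exists
  obtain ⟨m, hm⟩ := hB t b h0 hbt.1 hbt.2 hb
  have h1 : DifferentiableWithinAt ℝ (fun s => f t + m * (s - t)) (Icc t l) t := by fun_prop
  refine h1.congr_of_eventuallyEq ?_ (by simp)
  have : Iio b ∈ 𝓝 t := Iio_mem_nhds hbt.1
  filter_upwards [mem_nhdsWithin_of_mem_nhds this, self_mem_nhdsWithin] with s hs hs'
  exact hm s ⟨hs'.1, le_of_lt hs⟩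

theorem IsIntegralPL.differentiableLeft {l : ℝ} {f : ℝ → ℝ} (hf : IsIntegralPL l f) {t : ℝ}
    (h0 : 0 < t) (hl : t ≤ l) : DifferentiableWithinAt ℝ f (Icc 0 t) t := by
  obtain ⟨B, hB⟩ := hf
  have hev : ∀ᶠ a in 𝓝[<] t, ∀ x ∈ B, x ∉ Ioo a t := by
    refine (Filter.eventually_all_finset B).2 fun x _ => ?_
    rcases le_or_gt t x with h | h
    · exact Eventually.of_forall fun b hb => absurd hb.2 (not_lt.2 h)
    · filter_upwards [Ioo_mem_nhdsLT h] with b hb hx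
      exact absurd hx.1 (not_lt.2 hb.1.le)
  obtain ⟨a, ha, hat⟩ := (hev.and (Ico_mem_nhdsLT h0)).exists
  obtain ⟨m, hm⟩ := hB a t hat.1 hat.2 hl ha
  have h1 : DifferentiableWithinAt ℝ (fun s => f a + m * (s - a)) (Icc 0 t) t := by fun_prop
  refine h1.congr_of_eventuallyEq ?_ (hm t ⟨hat.2.le, le_rfl⟩)
  have : Ioi a ∈ 𝓝 t := Ioi_mem_nhds hat.2
  filter_upwards [mem_nhdsWithin_of_mem_nhds this, self_mem_nhdsWithin] with s hs hs'
  exact hm s ⟨le_of_lt hs, hs'.2⟩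

theorem IsRational.zero : Γ.IsRational (fun _ => 0) := fun _ => IsIntegralPL.zero _

theorem IsRational.neg {φ : Γ.Point → ℝ} (h : Γ.IsRational φ) :
    Γ.IsRational (fun p => - φ p) := fun e => (h e).neg

theorem IsRational.add {φ ψ : Γ.Point → ℝ} (h : Γ.IsRational φ) (h' : Γ.IsRational ψ) :
    Γ.IsRational (fun p => φ p + ψ p) := fun e => (h e).add (h' e)

theorem slopeRight_add {φ ψ : Γ.Point → ℝ} (h : Γ.IsRational φ) (h' : Γ.IsRational ψ) (e : E)
    {t : ℝ} (h0 : 0 ≤ t) (hl : t < Γ.len e) :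
    Γ.slopeRight (fun p => φ p + ψ p) e t = Γ.slopeRight φ e t + Γ.slopeRight ψ e t :=
  derivWithin_fun_add ((h e).differentiableRight h0 hl) ((h' e).differentiableRight h0 hl)

theorem slopeLeft_add {φ ψ : Γ.Point → ℝ} (h : Γ.IsRational φ) (h' : Γ.IsRational ψ) (e : E)
    {t : ℝ} (h0 : 0 < t) (hl : t ≤ Γ.len e) :
    Γ.slopeLeft (fun p => φ p + ψ p) e t = Γ.slopeLeft φ e t + Γ.slopeLeft ψ e t :=
  derivWithin_fun_add ((h e).differentiableLeft h0 hl) ((h' e).differentiableLeft h0 hl)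

theorem slopeRight_neg (φ : Γ.Point → ℝ) (e : E) (t : ℝ) :
    Γ.slopeRight (fun p => - φ p) e t = - Γ.slopeRight φ e t :=
  derivWithin.fun_neg

theorem slopeLeft_neg (φ : Γ.Point → ℝ) (e : E) (t : ℝ) :
    Γ.slopeLeft (fun p => - φ p) e t = - Γ.slopeLeft φ e t :=
  derivWithin.fun_neg

theorem ord_zero [Fintype E] [DecidableEq V] (p : Γ.Point) : Γ.ord (fun _ => 0) p = 0 := by
  cases p <;> simp [ord, slopeLeft, slopeRight]

theorem ord_neg [Fintype E] [DecidableEq V] (φ : Γ.Point → ℝ) (p : Γ.Point) :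
    Γ.ord (fun p => - φ p) p = - Γ.ord φ p := by
  cases p with
  | vertex v =>
    have key : ∀ (P : E → Prop) [DecidablePred P] (x : E → ℝ),
        (∑ e, if P e then - x e else 0) = - ∑ e, if P e then x e else 0 := by
      intro P _ x
      rw [← Finset.sum_neg_distrib]
      exact Finset.sum_congr rfl fun e _ => by split_ifs <;> simp
    simp only [ord, slopeLeft_neg, slopeRight_neg, key]
    ring
  | inner e t h0 h1 => simp only [ord, slopeLeft_neg, slopeRight_neg]; ring

theorem ord_add [Fintype E] [DecidableEq V] {φ ψ : Γ.Point → ℝ} (h : Γ.IsRational φ)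
    (h' : Γ.IsRational ψ) (p : Γ.Point) :
    Γ.ord (fun p => φ p + ψ p) p = Γ.ord φ p + Γ.ord ψ p := by
  cases p with
  | vertex v =>
    have key : ∀ (P : E → Prop) [DecidablePred P] (x y : E → ℝ),
        (∑ e, if P e then x e + y e else 0)
          = (∑ e, if P e then x e else 0) + ∑ e, if P e then y e else 0 := by
      intro P _ x y
      rw [← Finset.sum_add_distrib]
      exact Finset.sum_congr rfl fun e _ => by split_ifs <;> simp
    simp only [ord, slopeLeft_add h h' _ (Γ.len_pos _) le_rfl,
      slopeRight_add h h' _ le_rfl (Γ.len_pos _), key]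
    ring
  | inner e t h0 h1 =>
    simp only [ord, slopeLeft_add h h' e h0 h1.le, slopeRight_add h h' e h0.le h1]
    ring

theorem Divisor.LinEquiv.refl [Fintype E] [DecidableEq V] (D : Γ.Divisor) : D.LinEquiv D :=
  ⟨_, IsRational.zero, fun p => by simp [ord_zero]⟩

theorem Divisor.LinEquiv.symm [Fintype E] [DecidableEq V] {D₁ D₂ : Γ.Divisor}
    (h : D₁.LinEquiv D₂) : D₂.LinEquiv D₁ := by
  obtain ⟨φ, hφ, h⟩ := h
  exact ⟨_, hφ.neg, fun p => by rw [ord_neg, ← h p]; push_cast; ring⟩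

theorem Divisor.LinEquiv.trans [Fintype E] [DecidableEq V] {D₁ D₂ D₃ : Γ.Divisor}
    (h : D₁.LinEquiv D₂) (h' : D₂.LinEquiv D₃) : D₁.LinEquiv D₃ := by
  obtain ⟨φ, hφ, h⟩ := h
  obtain ⟨ψ, hψ, h'⟩ := h'
  exact ⟨_, hφ.add hψ, fun p => by rw [ord_add hφ hψ, ← h p, ← h' p]; push_cast; ring⟩

variable (Γ)

/-! ### Divisor classes of degree `d` -/

/-- `Div^d(Γ)`, the divisors of degree `d`. -/
def DivDeg (d : ℤ) : Type _ := {D : Γ.Divisor // D.degree = d}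

/-- Linear equivalence on `Div^d(Γ)`. -/
def linSetoid [Fintype E] [DecidableEq V] (d : ℤ) : Setoid (Γ.DivDeg d) where
  r D₁ D₂ := Divisor.LinEquiv D₁.1 D₂.1
  iseqv := ⟨fun D => .refl D.1, fun h => h.symm, fun h h' => h.trans h'⟩

/-- `Pic^d(Γ)`, the linear equivalence classes of divisors of degree `d`. -/
def Pic [Fintype E] [DecidableEq V] (d : ℤ) : Type _ := Quotient (Γ.linSetoid d)

/-- The class `[D]` of a divisor `D` of degree `d`. -/
def picMk [Fintype E] [DecidableEq V] (d : ℤ) (D : Γ.DivDeg d) : Γ.Pic d :=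
  Quotient.mk (Γ.linSetoid d) D

/-- The effective locus `W_d`: the classes of effective divisors of degree `d`. -/
def effectiveLocus [Fintype E] [DecidableEq V] (d : ℤ) : Set (Γ.Pic d) :=
  {c | ∃ D : Γ.DivDeg d, D.1.IsEffective ∧ Γ.picMk d D = c}

/-! ### Genus, tropical Jacobian and Abel-Jacobi map -/

/-- The boundary map `∂ : C₁(Γ, ℝ) → C₀(Γ, ℝ)`, `∂ e = tgt e - src e`. -/
def boundary [Fintype E] [DecidableEq V] : (E → ℝ) →ₗ[ℝ] (V → ℝ) where
  toFun c v := ∑ e, c e * ((if Γ.tgt e = v then 1 else 0) - if Γ.src e = v then 1 else 0)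
  map_add' c c' := by
    funext v
    simp only [Pi.add_apply, add_mul, Finset.sum_add_distrib]
  map_smul' r c := by
    funext v
    simp only [Pi.smul_apply, smul_eq_mul, RingHom.id_apply, Finset.mul_sum, mul_assoc]

/-- `H₁(Γ, ℝ)`, the space of real cycles. -/
def H1 [Fintype E] [DecidableEq V] : Submodule ℝ (E → ℝ) := LinearMap.ker Γ.boundary

/-- The genus `g = dim H₁(Γ, ℝ)`. -/
def genus [Fintype E] [DecidableEq V] : ℕ := Module.finrank ℝ Γ.H1

/-- `H₁(Γ, ℤ)`, as the lattice of integral cycles in `H₁(Γ, ℝ)`. -/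
def H1Int [Fintype E] [DecidableEq V] : AddSubgroup Γ.H1 where
  carrier := {c | ∀ e, ∃ n : ℤ, c.1 e = n}
  zero_mem' _ := ⟨0, by simp⟩
  add_mem' {a b} ha hb e := by
    obtain ⟨m, hm⟩ := ha e
    obtain ⟨n, hn⟩ := hb e
    exact ⟨m + n, by simp [hm, hn]⟩
  neg_mem' {a} ha e := by
    obtain ⟨m, hm⟩ := ha e
    exact ⟨-m, by simp [hm]⟩

/-- The tropical Jacobian `Jac(Γ) = H₁(Γ, ℝ) / H₁(Γ, ℤ)`, with the quotient topology. -/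
abbrev Jac [Fintype E] [DecidableEq V] : Type _ := Γ.H1 ⧸ Γ.H1Int

/-- The linear form `ω ↦ ∫_c ω` on `H₁(Γ, ℝ)`, which is identified with the space of harmonic
`1`-forms: the form `ω` is `ω_e dt` along the edge `e`, so its integral over the `1`-chain `c` is
`∑ e, len e * c e * ω_e`. -/
def integral [Fintype E] [DecidableEq V] : (E → ℝ) →ₗ[ℝ] Module.Dual ℝ Γ.H1 :=
  LinearMap.mk₂ ℝ (fun (c : E → ℝ) (ω : Γ.H1) => ∑ e, Γ.len e * c e * ω.1 e)
    (fun c c' ω => by simp only [Pi.add_apply, mul_add, add_mul, Finset.sum_add_distrib])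
    (fun r c ω => by
      simp only [Pi.smul_apply, smul_eq_mul, Finset.mul_sum]
      exact Finset.sum_congr rfl fun e _ => by ring)
    (fun c ω ω' => by
      simp only [Submodule.coe_add, Pi.add_apply, mul_add, Finset.sum_add_distrib])
    (fun r c ω => by
      simp only [Submodule.coe_smul, Pi.smul_apply, smul_eq_mul, Finset.mul_sum]
      exact Finset.sum_congr rfl fun e _ => by ring)

theorem integral_restrict_injective [Fintype E] [DecidableEq V] :
    Function.Injective (Γ.integral ∘ₗ Γ.H1.subtype) := by
  rw [← LinearMap.ker_eq_bot, LinearMap.ker_eq_bot']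
  intro h hh
  have h0 : ∑ e, Γ.len e * h.1 e * h.1 e = 0 := LinearMap.congr_fun hh h
  rw [Finset.sum_eq_zero_iff_of_nonneg fun e _ => by
    rw [mul_assoc]; exact mul_nonneg (Γ.len_pos e).le (mul_self_nonneg _)] at h0
  ext e
  have := h0 e (Finset.mem_univ e)
  simpa [(Γ.len_pos e).ne'] using this

/-- The duality isomorphism `H₁(Γ, ℝ) ≃ H₁(Γ, ℝ)^*`, `c ↦ ∫_c`, given by the length pairing. -/
def duality [Fintype E] [DecidableEq V] : Γ.H1 ≃ₗ[ℝ] Module.Dual ℝ Γ.H1 :=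
  LinearEquiv.ofInjectiveOfFinrankEq (Γ.integral ∘ₗ Γ.H1.subtype) Γ.integral_restrict_injective
    Subspace.dual_finrank_eq.symm

/-- The class in `H₁(Γ, ℝ) ≃ H₁(Γ, ℝ)^*` of integration over the `1`-chain `c`, that is, the
orthogonal projection of `c` to `H₁(Γ, ℝ)` with respect to the length pairing. -/
def cycleOfChain [Fintype E] [DecidableEq V] (c : E → ℝ) : Γ.H1 :=
  Γ.duality.symm (Γ.integral c)

theorem exists_integral_chain [Fintype E] [DecidableEq V] [DecidableEq E] (u v : V) :
    ∃ c : E → ℤ, Γ.boundary (fun e => (c e : ℝ)) = Pi.single v 1 - Pi.single u 1 := by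
  induction Γ.connected u v with
  | rel a b h =>
    obtain ⟨e, rfl, rfl⟩ := h
    refine ⟨Pi.single e 1, ?_⟩
    funext w
    simp [boundary, Pi.single_apply, eq_comm]
  | refl a => exact ⟨0, by funext w; simp [boundary]⟩
  | symm a b _ ih =>
    obtain ⟨c, hc⟩ := ih
    refine ⟨-c, ?_⟩
    have : (fun e => (((-c) e : ℤ) : ℝ)) = - fun e => (c e : ℝ) := by funext e; simp
    rw [this, map_neg, hc, neg_sub]
  | trans a b d _ _ ih ih' =>
    obtain ⟨c, hc⟩ := ih
    obtain ⟨c', hc'⟩ := ih'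
    refine ⟨c + c', ?_⟩
    have : (fun e => (((c + c') e : ℤ) : ℝ)) = (fun e => (c e : ℝ)) + fun e => (c' e : ℝ) := by
      funext e; simp
    rw [this, map_add, hc, hc']
    abel

/-- A `1`-chain of a path from the vertex `u` to the vertex `v` of `Γ`.  Two choices differ by an
element of `H₁(Γ, ℤ)`. -/
def vertexPath [Fintype E] [DecidableEq V] [DecidableEq E] (u v : V) : E → ℝ :=
  fun e => ((Γ.exists_integral_chain u v).choose e : ℝ)

variable {Γ} in
/-- The vertex from which a point is reached: itself, or the source of the edge containing it. -/
def Point.foot : Γ.Point → V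
  | .vertex v => v
  | .inner e _ _ _ => Γ.src e

variable {Γ} in
/-- The `1`-chain of the segment from `p.foot` to `p`; the initial piece of length `t` of `e` is
the fraction `t / len e` of the chain `e`. -/
def Point.tail [DecidableEq E] : Γ.Point → (E → ℝ)
  | .vertex _ => 0
  | .inner e t _ _ => Pi.single e (t / Γ.len e)

/-- The `1`-chain of a path from `q` to `p`. -/
def pathChain [Fintype E] [DecidableEq V] [DecidableEq E] (q p : Γ.Point) : E → ℝ :=
  Γ.vertexPath q.foot p.foot + p.tail - q.tail

/-- The Abel-Jacobi map `Φ_q : Γ → Jac(Γ)` with base point `q`, sending `p` to the functional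
`∫_q^p`. -/
def abelJacobi [Fintype E] [DecidableEq V] [DecidableEq E] (q p : Γ.Point) : Γ.Jac :=
  QuotientAddGroup.mk (Γ.cycleOfChain (Γ.pathChain q p))

/-- The map `Φ_q^{(d)} : Div^d(Γ) → Jac(Γ)`, the additive extension of `Φ_q`. -/
def abelJacobiDiv [Fintype E] [DecidableEq V] [DecidableEq E] (q : Γ.Point) (d : ℤ)
    (D : Γ.DivDeg d) : Γ.Jac :=
  D.1.sum fun p n => n • Γ.abelJacobi q p

/-- The topology that `Pic^d(Γ)` inherits from `Jac(Γ)` through `Φ_q^{(d)}`: a set of classes is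
open if and only if the set of divisors in these classes is the preimage under `Φ_q^{(d)}` of
an open subset of `Jac(Γ)`. -/
abbrev picTopology [Fintype E] [DecidableEq V] [DecidableEq E] (q : Γ.Point) (d : ℤ) :
    TopologicalSpace (Γ.Pic d) :=
  TopologicalSpace.coinduced (Γ.picMk d)
    (TopologicalSpace.induced (Γ.abelJacobiDiv q d) inferInstance)

end

end MetricGraph

/-!
# Generic effective divisor classes on a metric graph have the expected rank

By Abel's theorem and its converse, divisors of the same degree are linearly equivalent exactly when
their images in the Jacobian agree. Both directions go through the values at the vertices and the
final slopes on the edges of a rational function (`HasPotential`): given the divisor, these data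
determine the function, since on each edge the divisor prescribes its bends.

Let `k = max (d - g) 0`, let `v` be a vertex, and let `U` consist of the classes `[D]` in `W_d` for
which `D - (k + 1) v` is not equivalent to an effective divisor. The effective classes of a given
degree form a compact subset of the Jacobian, so `U` is open, and the divisors with class in `U` have
rank at most `k`. Their rank is at least `k` because every class of degree `g` is effective if
`d ≥ g`, and trivially if `d < g`. What remains is the density of `U` and Riemann's inequality
`W_g = Pic^g`. Both rest on coconnected sets of edges: sets `F` whose complement still connects all
the vertices. Such a set has at most `g` edges, and it can be enlarged if it has fewer.

* *Rigidity* (`IsCoconnected.apply_vertex_eq_zero_of_linEquiv`). If `R` has one point in the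
  interior of each edge of a coconnected set, then no effective divisor equivalent to `R` contains a
  vertex: the edges without chips connect the vertices on which a function carrying `R` to an
  effective divisor is minimal to all the others.
* *Transport* (`exists_move_into_cut`, `exists_transport`). If every edge across a cut carries a
  chip, then these chips can be moved simultaneously to one side until one of them reaches a vertex
  there. Starting with chips on a coconnected set `F` and one more chip at a vertex, and choosing
  a minimal cut between that vertex and a target `p`, either two edges without chips cross the cut
  and the additional chip can be put on one of them, which gives a larger coconnected set, or a chip
  moves to a vertex closer to `p`. Coconnectedness survives as an edge is exchanged for
  another one across the cut (`IsCoconnected.exchange`).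
* Hence each effective class of degree `d ≤ g` is represented by chips on the closed edges of a
  coconnected set (`exists_edgesClass_eq`). A small perturbation moves the chips into the interiors
  of these edges, and by rigidity the result lies in `U` after `k v` is added.
* For `d = g + 1` no larger coconnected set exists, so that a chip can be brought to any vertex.
  It follows that the set of effective classes of degree `g` is stable under translation by
  `x - p` for all points `x` and vertices `p` (`add_sub_mem_effectiveClasses`). These translations
  generate the Jacobian as a semigroup, so all classes of degree `g` are effective
  (`effectiveClasses_genus`).
-/

namespace MetricGraph

noncomputable section

section Cycles

variable {V E : Type*} [Fintype E] [DecidableEq V] (Γ : MetricGraph V E)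

/-! ### Cycles, cuts and potentials -/

/-- The orthogonal projection of real `1`-chains onto `H₁(Γ, ℝ)` for the length pairing, as a
linear map. -/
def cycleProj : (E → ℝ) →ₗ[ℝ] Γ.H1 := Γ.duality.symm.toLinearMap ∘ₗ Γ.integral

/-- The class in the Jacobian of integration over a `1`-chain. -/
def chainClass : (E → ℝ) →+ Γ.Jac :=
  (QuotientAddGroup.mk' Γ.H1Int).comp Γ.cycleProj.toAddMonoidHom

theorem cycleProj_eq_zero_iff (c : E → ℝ) :
    Γ.cycleProj c = 0 ↔ ∀ ω : Γ.H1, ∑ e, Γ.len e * c e * ω.1 e = 0 := by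
  simp only [cycleProj, LinearMap.comp_apply, LinearEquiv.coe_coe,
    LinearEquiv.map_eq_zero_iff]
  exact LinearMap.ext_iff

theorem cycleProj_coe (ω : Γ.H1) : Γ.cycleProj ω.1 = ω :=
  Γ.duality.symm_apply_apply ω

theorem chainClass_eq_zero_of_mem_H1Int {ω : Γ.H1} (h : ω ∈ Γ.H1Int) :
    Γ.chainClass ω.1 = 0 := by
  simp only [chainClass, AddMonoidHom.comp_apply, LinearMap.toAddMonoidHom_coe, cycleProj_coe]
  exact (QuotientAddGroup.eq_zero_iff ω).2 h

theorem chainClass_eq_zero_iff (c : E → ℝ) :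
    Γ.chainClass c = 0 ↔ Γ.cycleProj c ∈ Γ.H1Int :=
  QuotientAddGroup.eq_zero_iff _

theorem sum_mul_boundary [Fintype V] (f : V → ℝ) (c : E → ℝ) :
    ∑ v, f v * Γ.boundary c v = ∑ e, (f (Γ.tgt e) - f (Γ.src e)) * c e := by
  simp only [boundary, LinearMap.coe_mk, AddHom.coe_mk, Finset.mul_sum]
  rw [Finset.sum_comm]
  refine Finset.sum_congr rfl fun e _ => ?_
  simp only [mul_sub, Finset.sum_sub_distrib, mul_ite, mul_one, mul_zero, Finset.sum_ite_eq,
    Finset.mem_univ, if_true]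
  ring

theorem sum_coboundary_mul [Fintype V] (f : V → ℝ) (ω : Γ.H1) :
    ∑ e, (f (Γ.tgt e) - f (Γ.src e)) * ω.1 e = 0 := by
  have h : Γ.boundary ω.1 = 0 := ω.2
  rw [← sum_mul_boundary, h]
  simp

theorem boundary_single [DecidableEq E] (e : E) :
    Γ.boundary (Pi.single e 1) = Pi.single (Γ.tgt e) 1 - Pi.single (Γ.src e) 1 := by
  funext w
  simp [boundary, Pi.single_apply, eq_comm]

/-- A cochain that vanishes on all cycles is a coboundary. -/
theorem exists_potential [Fintype V] (x : E → ℝ) (hx : ∀ ω : Γ.H1, ∑ e, x e * ω.1 e = 0) :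
    ∃ f : V → ℝ, ∀ e, x e = f (Γ.tgt e) - f (Γ.src e) := by
  classical
  let L : Module.Dual ℝ (E → ℝ) := ∑ e, x e • LinearMap.proj e
  have hL : ∀ c, L c = ∑ e, x e * c e := fun c => by simp [L]
  have hmem : L ∈ LinearMap.range Γ.boundary.dualMap := by
    rw [LinearMap.range_dualMap_eq_dualAnnihilator_ker, Submodule.mem_dualAnnihilator]
    intro c hc
    rw [hL]
    exact hx ⟨c, hc⟩
  obtain ⟨g, hg⟩ := hmem
  refine ⟨fun v => g (Pi.single v 1), fun e => ?_⟩
  have h1 := LinearMap.congr_fun hg (Pi.single e 1)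
  rw [hL, LinearMap.dualMap_apply, boundary_single, map_sub] at h1
  rw [h1]
  simp [Pi.single_apply]

/-- Integration over a chain `c` kills all harmonic forms exactly when `len e * c e` is the
increment along `e` of a potential on the vertices. -/
theorem cycleProj_eq_zero_iff_exists [Fintype V] (c : E → ℝ) :
    Γ.cycleProj c = 0 ↔ ∃ f : V → ℝ, ∀ e, Γ.len e * c e = f (Γ.tgt e) - f (Γ.src e) := by
  rw [cycleProj_eq_zero_iff]
  constructor
  · exact Γ.exists_potential _
  · rintro ⟨f, hf⟩ ω
    simp only [hf]
    exact Γ.sum_coboundary_mul f ω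

theorem chainClass_eq_zero_of_potential [Fintype V] (c : E → ℝ) (f : V → ℝ)
    (h : ∀ e, Γ.len e * c e = f (Γ.tgt e) - f (Γ.src e)) : Γ.chainClass c = 0 := by
  rw [chainClass_eq_zero_iff, (Γ.cycleProj_eq_zero_iff_exists c).2 ⟨f, h⟩]
  exact zero_mem _

theorem chainClass_eq_zero_of_boundary {c : E → ℤ} (h : Γ.boundary (fun e => (c e : ℝ)) = 0) :
    Γ.chainClass (fun e => (c e : ℝ)) = 0 :=
  Γ.chainClass_eq_zero_of_mem_H1Int (ω := ⟨_, h⟩) fun e => ⟨c e, rfl⟩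

theorem sum_boundary [Fintype V] (c : E → ℝ) : ∑ v, Γ.boundary c v = 0 := by
  simpa using Γ.sum_mul_boundary (fun _ => 1) c

end Cycles

/-! ### Cuts and coconnected sets of edges -/

section Cuts

variable {V E : Type*} (Γ : MetricGraph V E)

/-- The edge `e` crosses the cut of the vertex set `X`: exactly one of its ends is in `X`. -/
def Crosses (X : Set V) (e : E) : Prop := ¬ (Γ.src e ∈ X ↔ Γ.tgt e ∈ X)

/-- A set `F` of edges is coconnected if the edges outside `F` connect all the vertices; this is
expressed by cuts: every nonempty proper set of vertices is crossed by an edge outside `F`. -/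
def IsCoconnected (F : Finset E) : Prop :=
  ∀ X : Set V, X.Nonempty → X ≠ univ → ∃ e ∉ F, Γ.Crosses X e

variable {Γ}

theorem crosses_compl {X : Set V} {e : E} : Γ.Crosses Xᶜ e ↔ Γ.Crosses X e := by
  simp only [Crosses, mem_compl_iff]; tauto

theorem Crosses.nonempty {X : Set V} {e : E} (h : Γ.Crosses X e) : X.Nonempty := by
  by_contra hX
  rw [not_nonempty_iff_eq_empty] at hX
  simp [Crosses, hX] at h

theorem Crosses.ne_univ {X : Set V} {e : E} (h : Γ.Crosses X e) : X ≠ univ := by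
  rintro rfl
  simp [Crosses] at h

theorem IsCoconnected.mono {F G : Finset E} (hG : Γ.IsCoconnected G) (h : F ⊆ G) :
    Γ.IsCoconnected F := fun X h1 h2 => by
  obtain ⟨e, he, hX⟩ := hG X h1 h2
  exact ⟨e, fun h' => he (h h'), hX⟩

theorem isCoconnected_empty : Γ.IsCoconnected ∅ := by
  intro X ⟨u, hu⟩ hX
  by_contra hne
  push Not at hne
  refine hX (eq_univ_of_forall fun v => ?_)
  have key : ∀ a b, Relation.EqvGen (fun a b => ∃ e, Γ.src e = a ∧ Γ.tgt e = b) a b →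
      (a ∈ X ↔ b ∈ X) := by
    intro a b hab
    induction hab with
    | rel a b h =>
      obtain ⟨e, rfl, rfl⟩ := h
      exact not_not.1 (hne e (by simp))
    | refl => rfl
    | symm a b _ ih => exact ih.symm
    | trans a b c _ _ ih ih' => exact ih.trans ih'
  exact (key u v (Γ.connected u v)).1 hu

/-- If `h` is the only edge outside the coconnected set `F` that crosses `X`, then `h` may be
exchanged for any edge `j` that crosses `X`. -/
theorem IsCoconnected.exchange {F G : Finset E} (hF : Γ.IsCoconnected F) {X : Set V} {h j : E}
    (hX : ∀ e, Γ.Crosses X e → e ∉ F → e = h) (hj : Γ.Crosses X j)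
    (hG : ∀ e ∈ G, (e ∈ F ∨ e = h) ∧ e ≠ j) : Γ.IsCoconnected G := by
  intro Z hZ hZ'
  by_contra hne
  push Not at hne
  have hcr : ∀ e, Γ.Crosses Z e → e ∈ G := fun e he => by
    by_contra h'
    exact hne e h' he
  have hjZ : ¬ Γ.Crosses Z j := fun h' => (hG j (hcr j h')).2 rfl
  have hhX : Γ.Crosses X h := by
    obtain ⟨e, he, hc⟩ := hF X hj.nonempty hj.ne_univ
    rwa [← hX e hc he]
  have hhZ : Γ.Crosses Z h := by
    obtain ⟨e, he, hc⟩ := hF Z hZ hZ'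
    rcases (hG e (hcr e hc)).1 with h' | rfl
    · exact absurd h' he
    · exact hc
  -- `X` and `Z` are crossed by the same edges outside `F`, so their symmetric difference by none.
  let S : Set V := {v | ¬ (v ∈ X ↔ v ∈ Z)}
  have hS : ∀ e ∉ F, ¬ Γ.Crosses S e := by
    intro e he hc
    by_cases h1 : e = h
    · subst h1
      simp only [Crosses, S, mem_ofPred_eq] at hc hhX hhZ
      tauto
    · have h2 : ¬ Γ.Crosses X e := fun h' => h1 (hX e h' he)
      have h3 : ¬ Γ.Crosses Z e := fun h' => by
        rcases (hG e (hcr e h')).1 with h' | h'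
        · exact he h'
        · exact h1 h'
      simp only [Crosses, S, mem_ofPred_eq] at hc h2 h3
      tauto
  by_cases hSn : S.Nonempty
  · by_cases hSu : S = univ
    · have hs := eq_univ_iff_forall.1 hSu
      have h1 := hs (Γ.src j)
      have h2 := hs (Γ.tgt j)
      simp only [Crosses, S, mem_ofPred_eq] at hj hjZ h1 h2
      tauto
    · obtain ⟨e, he, hc⟩ := hF S hSn hSu
      exact hS e he hc
  · rw [not_nonempty_iff_eq_empty] at hSn
    have hs : ∀ v, v ∉ S := fun v => by simp [hSn]
    have h1 := hs (Γ.src j)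
    have h2 := hs (Γ.tgt j)
    simp only [Crosses, S, mem_ofPred_eq] at hj hjZ h1 h2
    tauto

/-- A function on the vertices that is unchanged along the edges outside a coconnected set is
constant. -/
theorem IsCoconnected.eq_of_forall {F : Finset E} (hF : Γ.IsCoconnected F) {f : V → ℝ}
    (hf : ∀ e ∉ F, f (Γ.tgt e) = f (Γ.src e)) (u v : V) : f u = f v := by
  by_contra hne
  obtain ⟨e, he, hc⟩ := hF {w | f w = f u} ⟨u, rfl⟩ fun h => hne (eq_univ_iff_forall.1 h v).symm
  simp [Crosses, hf e he] at hc

variable [Fintype E] [DecidableEq V] [Fintype V]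

/-- The edges of a coconnected set have linearly independent projections to `H₁(Γ, ℝ)`. -/
theorem IsCoconnected.card_le_genus {F : Finset E} (hF : Γ.IsCoconnected F) :
    F.card ≤ Γ.genus := by
  classical
  have hli : LinearIndependent ℝ (fun e : F => Γ.cycleProj (Pi.single e.1 1)) := by
    rw [Fintype.linearIndependent_iff]
    intro x hx i
    let c : E → ℝ := ∑ e : F, x e • Pi.single e.1 1
    have hc : Γ.cycleProj c = 0 := by simpa [c, map_sum] using hx
    have hc0 : ∀ e ∉ F, c e = 0 := fun e he => by
      simp only [c, Finset.sum_apply, Pi.smul_apply, smul_eq_mul]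
      refine Finset.sum_eq_zero fun j _ => ?_
      have : e ≠ j.1 := fun h => he (h ▸ j.2)
      simp [this]
    have hci : c i.1 = x i := by
      simp [c, Finset.sum_apply, Pi.single_apply]
    obtain ⟨f, hf⟩ := (Γ.cycleProj_eq_zero_iff_exists c).1 hc
    have h1 := hf i.1
    rw [hF.eq_of_forall (f := f) (fun e he => by
      have := hf e
      rw [hc0 e he, mul_zero] at this
      linarith) (Γ.tgt i.1) (Γ.src i.1), sub_self, hci] at h1
    exact (mul_eq_zero.1 h1).resolve_left (Γ.len_pos _).ne'
  simpa [genus] using hli.fintype_card_le_finrank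

/-- A coconnected set with fewer than `g` edges can be enlarged: otherwise a cycle vanishing on it
would vanish on every edge. -/
theorem IsCoconnected.exists_insert [DecidableEq E] {F : Finset E}
    (hF : Γ.IsCoconnected F) (hcard : F.card < Γ.genus) : ∃ c ∉ F, Γ.IsCoconnected (insert c F) := by
  by_contra hne
  push Not at hne
  let ρ : Γ.H1 →ₗ[ℝ] (F → ℝ) := LinearMap.pi fun e => LinearMap.proj e.1 ∘ₗ Γ.H1.subtype
  have hinj : Function.Injective ρ := by
    rw [← LinearMap.ker_eq_bot, LinearMap.ker_eq_bot']
    intro ω hω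
    have h0 : ∀ e ∈ F, ω.1 e = 0 := fun e he => congrFun hω ⟨e, he⟩
    ext c
    by_cases hc : c ∈ F
    · exact h0 c hc
    have h1 := hne c hc
    simp only [IsCoconnected, not_forall, not_exists, not_and] at h1
    obtain ⟨X, hX, hX', hcr⟩ := h1
    classical
    have h2 := Γ.sum_coboundary_mul (fun v => if v ∈ X then 1 else 0) ω
    rw [Finset.sum_eq_single c] at h2
    · rcases mul_eq_zero.1 h2 with h3 | h3
      · have h4 : ∀ e ∉ F, ¬ Γ.Crosses X e := fun e he => by
          by_cases hec : e = c
          · subst hec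
            simp only [Crosses, not_not]
            split_ifs at h3 <;> first | tauto | norm_num at h3
          · exact hcr e (by simp [hec, he])
        obtain ⟨e, he, hc⟩ := hF X hX hX'
        exact absurd hc (h4 e he)
      · simpa using h3
    · intro e _ hec
      by_cases he : e ∈ F
      · rw [h0 e he, mul_zero]
      · have h5 := hcr e (by simp [hec, he])
        simp only [Crosses, not_not] at h5
        simp [h5]
    · simp
  have := LinearMap.finrank_le_finrank_of_injective hinj
  rw [Module.finrank_fintype_fun_eq_card, Fintype.card_coe] at this
  exact absurd hcard (not_lt.2 this)

end Cuts

/-! ### The Abel-Jacobi map in terms of chains -/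

section AbelJacobi

variable {V E : Type*} {Γ : MetricGraph V E}

/-- The additive extension of a weight on the points of `Γ` to divisors. -/
def weight {A : Type*} [AddCommGroup A] (w : Γ.Point → A) : Γ.Divisor →+ A :=
  Finsupp.liftAddHom fun p => zmultiplesHom A (w p)

theorem weight_single {A : Type*} [AddCommGroup A] (w : Γ.Point → A) (p : Γ.Point) (n : ℤ) :
    weight w (Finsupp.single p n) = n • w p := by
  simp [weight]

theorem degree_eq_weight (D : Γ.Divisor) : D.degree = weight (fun _ => (1 : ℤ)) D := by
  simp [Divisor.degree, weight, Finsupp.sum]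

theorem degree_add (D₁ D₂ : Γ.Divisor) :
    Divisor.degree (D₁ + D₂) = D₁.degree + D₂.degree := by
  simp only [degree_eq_weight, map_add]

theorem degree_sub (D₁ D₂ : Γ.Divisor) :
    Divisor.degree (D₁ - D₂) = D₁.degree - D₂.degree := by
  simp only [degree_eq_weight, map_sub]

theorem degree_single (p : Γ.Point) (n : ℤ) :
    Divisor.degree (Γ := Γ) (Finsupp.single p n) = n := by
  simp [degree_eq_weight, weight_single]

theorem edgePoint_zero (e : E) : Γ.edgePoint e 0 = .vertex (Γ.src e) := by simp [edgePoint]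

theorem edgePoint_len (e : E) : Γ.edgePoint e (Γ.len e) = .vertex (Γ.tgt e) := by
  simp [edgePoint, Γ.len_pos e]

theorem edgePoint_inner (e : E) {t : ℝ} (h0 : 0 < t) (h1 : t < Γ.len e) :
    Γ.edgePoint e t = .inner e t h0 h1 := by simp [edgePoint, h0, h1]

variable [DecidableEq E]

/-- The indicator function of the interior of the edge `e`. -/
def edgeIndicator (e : E) : Γ.Point → ℤ
  | .vertex _ => 0
  | .inner e' _ _ _ => if e' = e then 1 else 0

/-- The position on `e` of an interior point of `e`, and `0` at the other points. -/
def edgePosition (e : E) : Γ.Point → ℝ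
  | .vertex _ => 0
  | .inner e' t _ _ => if e' = e then t else 0

/-- The degree of a divisor on the interior of the edge `e`. -/
def edgeDegree (e : E) : Γ.Divisor →+ ℤ := weight (edgeIndicator e)

/-- The sum of the positions on `e` of the points of a divisor in the interior of the edge `e`. -/
def edgeMoment (e : E) : Γ.Divisor →+ ℝ := weight (edgePosition e)

variable [Fintype E] [DecidableEq V]

/-- The degree of the divisor that arises from `D` when each of its points is moved to its foot. -/
def footDegree (v : V) (D : Γ.Divisor) : ℤ :=
  D (.vertex v) + ∑ e, if Γ.src e = v then edgeDegree e D else 0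

theorem footDegree_add (v : V) (D D' : Γ.Divisor) :
    footDegree v (D + D') = footDegree v D + footDegree v D' := by
  have : ∀ e : E, (if Γ.src e = v then edgeDegree e D + edgeDegree e D' else 0)
      = (if Γ.src e = v then edgeDegree e D else 0)
        + if Γ.src e = v then edgeDegree e D' else 0 := fun e => by split_ifs <;> simp
  simp only [footDegree, map_add, Finsupp.add_apply, this, Finset.sum_add_distrib]
  ring

theorem footDegree_single (v : V) (p : Γ.Point) (n : ℤ) :
    footDegree v (Finsupp.single p n) = if p.foot = v then n else 0 := by
  cases p with
  | vertex u =>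
    by_cases h : u = v
    · subst h
      simp [footDegree, edgeDegree, weight_single, edgeIndicator, Point.foot]
    · have h' : (Point.vertex u : Γ.Point) ≠ .vertex v := fun h' => h (by injection h')
      simp [footDegree, edgeDegree, weight_single, edgeIndicator, Point.foot, h,
        Finsupp.single_eq_of_ne' h']
  | inner e t h0 h1 =>
    simp only [footDegree, edgeDegree, weight_single, edgeIndicator, Point.foot]
    rw [Finset.sum_eq_single e]
    · by_cases h : Γ.src e = v <;> simp [h]
    · intro b _ hb
      simp [hb.symm]
    · simp

theorem sum_footDegree [Fintype V] (D : Γ.Divisor) : ∑ v, footDegree v D = D.degree := by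
  induction D using Finsupp.induction_linear with
  | zero => simp [footDegree, Divisor.degree]
  | add D D' h h' => simp only [footDegree_add, Finset.sum_add_distrib, h, h', degree_add]
  | single p n => simp [footDegree_single, degree_single]

theorem abelJacobi_eq_chainClass (q p : Γ.Point) :
    Γ.abelJacobi q p = Γ.chainClass (Γ.pathChain q p) := rfl

theorem abelJacobi_eq (q p : Γ.Point) :
    Γ.abelJacobi q p = Γ.abelJacobi q (.vertex p.foot) + Γ.chainClass p.tail := by
  simp only [abelJacobi_eq_chainClass, ← map_add]
  congr 1
  simp only [pathChain, Point.foot, Point.tail]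
  abel

theorem abelJacobi_tgt (q : Γ.Point) (e : E) :
    Γ.abelJacobi q (.vertex (Γ.tgt e))
      = Γ.abelJacobi q (.vertex (Γ.src e)) + Γ.chainClass (Pi.single e 1) := by
  let k (v : V) : E → ℤ := (Γ.exists_integral_chain q.foot v).choose
  have hk : ∀ v, Γ.boundary (Γ.vertexPath q.foot v) = Pi.single v 1 - Pi.single q.foot 1 :=
    fun v => (Γ.exists_integral_chain q.foot v).choose_spec
  have h := Γ.chainClass_eq_zero_of_boundary
    (c := k (Γ.tgt e) - k (Γ.src e) - Pi.single e 1) (by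
      have : (fun e' => (((k (Γ.tgt e) - k (Γ.src e) - Pi.single e 1 : E → ℤ) e' : ℤ) : ℝ))
          = Γ.vertexPath q.foot (Γ.tgt e) - Γ.vertexPath q.foot (Γ.src e) - Pi.single e 1 := by
        funext e'
        by_cases he : e' = e
        · subst he; simp [k, vertexPath]
        · simp [k, vertexPath, he]
      rw [this, map_sub, map_sub, hk, hk, boundary_single]
      abel)
  rw [← sub_eq_zero, ← sub_sub, abelJacobi_eq_chainClass, abelJacobi_eq_chainClass,
    ← map_sub, ← map_sub, ← h]
  congr 1
  funext e'
  by_cases he : e' = e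
  · subst he; simp [k, vertexPath, pathChain, Point.foot, Point.tail]
  · simp [k, vertexPath, pathChain, Point.foot, Point.tail, he]

theorem sum_boundary_smul_abelJacobi [Fintype V] (q : Γ.Point) (N : V → ℤ) (m : E → ℤ)
    (h : ∀ v, (N v : ℝ) = Γ.boundary (fun e => (m e : ℝ)) v) :
    ∑ v, N v • Γ.abelJacobi q (.vertex v) = Γ.chainClass (fun e => (m e : ℝ)) := by
  have hN : ∀ v, N v = ∑ e, m e * ((if Γ.tgt e = v then 1 else 0)
      - if Γ.src e = v then 1 else 0) := fun v => by
    have := h v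
    simp only [boundary, LinearMap.coe_mk, AddHom.coe_mk] at this
    exact_mod_cast this
  have hm : (fun e => (m e : ℝ)) = ∑ e, m e • Pi.single e (1 : ℝ) := by
    funext e
    simp [Pi.single_apply]
  rw [hm, map_sum]
  simp only [hN, Finset.sum_smul]
  rw [Finset.sum_comm]
  refine Finset.sum_congr rfl fun e _ => ?_
  simp only [mul_smul, ← Finset.smul_sum, sub_smul, Finset.sum_sub_distrib, ite_smul, one_smul,
    zero_smul, Finset.sum_ite_eq, Finset.mem_univ, if_true, map_zsmul]
  rw [abelJacobi_tgt, add_sub_cancel_left]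

/-- The additive extension of the Abel-Jacobi map to all divisors. -/
def ajHom (q : Γ.Point) : Γ.Divisor →+ Γ.Jac := weight (Γ.abelJacobi q)

theorem ajHom_single (q p : Γ.Point) (n : ℤ) :
    ajHom q (Finsupp.single p n) = n • Γ.abelJacobi q p := weight_single _ _ _

theorem ajHom_eq [Fintype V] (q : Γ.Point) (D : Γ.Divisor) :
    ajHom q D = ∑ v, footDegree v D • Γ.abelJacobi q (.vertex v)
      + Γ.chainClass (fun e => edgeMoment e D / Γ.len e) := by
  induction D using Finsupp.induction_linear with
  | zero =>
    have : (fun e => edgeMoment e (0 : Γ.Divisor) / Γ.len e) = 0 := by funext e; simp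
    rw [this]
    simp [footDegree]
  | add D D' h h' =>
    have : (fun e => edgeMoment e (D + D') / Γ.len e)
        = (fun e => edgeMoment e D / Γ.len e) + fun e => edgeMoment e D' / Γ.len e := by
      funext e; simp [add_div]
    rw [this, map_add, map_add, h, h']
    simp only [footDegree_add, add_smul, Finset.sum_add_distrib]
    abel
  | single p n =>
    have : (fun e => edgeMoment e (Finsupp.single p n) / Γ.len e) = n • p.tail := by
      funext e
      cases p with
      | vertex v => simp [edgeMoment, weight_single, edgePosition, Point.tail]
      | inner e' t h0 h1 =>
        by_cases he : e' = e
        · subst he; simp [edgeMoment, weight_single, edgePosition, Point.tail, mul_div_assoc]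
        · simp [edgeMoment, weight_single, edgePosition, Point.tail, he, Ne.symm he]
    rw [this, ajHom_single, abelJacobi_eq]
    rw [map_zsmul]
    simp [footDegree_single]

/-! ### Abel's theorem -/

/-- The combinatorial data of a rational function with divisor `D`: its values `f` at the vertices
and its final slopes `m` on the edges.  The first condition computes the increment along `e` from
`m e` and the bends prescribed by `D`; the second one is `div = D` at the vertices. -/
def HasPotential (D : Γ.Divisor) : Prop :=
  ∃ (f : V → ℝ) (m : E → ℤ),
    (∀ e, f (Γ.tgt e) - f (Γ.src e) = m e * Γ.len e + edgeMoment e D) ∧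
    ∀ v, (footDegree v D : ℝ) = Γ.boundary (fun e => (m e : ℝ)) v

theorem HasPotential.degree_eq_zero [Fintype V] {D : Γ.Divisor} (h : HasPotential D) :
    D.degree = 0 := by
  obtain ⟨f, m, -, h2⟩ := h
  rw [← sum_footDegree]
  have := Γ.sum_boundary (fun e => (m e : ℝ))
  simp only [← h2] at this
  exact_mod_cast this

theorem HasPotential.ajHom_eq_zero [Fintype V] {D : Γ.Divisor} (h : HasPotential D)
    (q : Γ.Point) : ajHom q D = 0 := by
  obtain ⟨f, m, h1, h2⟩ := h
  rw [ajHom_eq, sum_boundary_smul_abelJacobi q _ m h2, ← map_add]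
  refine Γ.chainClass_eq_zero_of_potential _ f fun e => ?_
  rw [h1, Pi.add_apply, mul_add, mul_div_cancel₀ _ (Γ.len_pos e).ne']
  ring

/-- A degree zero function on the vertices is the boundary of an integral chain. -/
theorem exists_boundary_eq [Fintype V] (N : V → ℤ) (hN : ∑ v, N v = 0) :
    ∃ m : E → ℤ, ∀ v, (N v : ℝ) = Γ.boundary (fun e => (m e : ℝ)) v := by
  obtain ⟨v₀⟩ := Γ.nonempty
  choose c hc using Γ.exists_integral_chain v₀
  refine ⟨∑ v, N v • c v, fun u => ?_⟩
  have : (fun e => (((∑ v, N v • c v : E → ℤ) e : ℤ) : ℝ))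
      = ∑ v, (N v : ℝ) • fun e => (c v e : ℝ) := by
    funext e
    simp
  rw [this, map_sum]
  simp only [map_smul, hc, Finset.sum_apply, Pi.smul_apply, Pi.sub_apply, smul_eq_mul, mul_sub,
    Finset.sum_sub_distrib, ← Finset.sum_mul]
  have h0 : ∑ v, (N v : ℝ) = 0 := by exact_mod_cast hN
  simp [h0, Pi.single_apply]

theorem hasPotential_of_ajHom_eq_zero [Fintype V] {D : Γ.Divisor} (hdeg : D.degree = 0)
    (q : Γ.Point) (h : ajHom q D = 0) : HasPotential D := by
  obtain ⟨m, hm⟩ := exists_boundary_eq (Γ := Γ) (fun v => footDegree v D)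
    (by rw [sum_footDegree, hdeg])
  rw [ajHom_eq, sum_boundary_smul_abelJacobi q _ m hm, ← map_add, chainClass_eq_zero_iff] at h
  -- The class of the chain is an integral cycle `z`, by which `m` has to be corrected.
  set z := Γ.cycleProj ((fun e => (m e : ℝ)) + fun e => edgeMoment e D / Γ.len e) with hz
  choose n hn using h
  have hbz : Γ.boundary z.1 = 0 := z.2
  have hn' : (fun e => (n e : ℝ)) = z.1 := by funext e; exact (hn e).symm
  have hcast : (fun e => ((m e - n e : ℤ) : ℝ)) = (fun e => (m e : ℝ)) - z.1 := by
    funext e; simp [hn]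
  have h0 : Γ.cycleProj ((fun e => ((m e - n e : ℤ) : ℝ)) + fun e => edgeMoment e D / Γ.len e)
      = 0 := by
    rw [hcast, sub_add_eq_add_sub, map_sub, cycleProj_coe, ← hz, sub_self]
  obtain ⟨f, hf⟩ := (Γ.cycleProj_eq_zero_iff_exists _).1 h0
  refine ⟨f, fun e => m e - n e, fun e => ?_, fun v => ?_⟩
  · rw [← hf, Pi.add_apply, mul_add, mul_div_cancel₀ _ (Γ.len_pos e).ne']
    ring
  · rw [hcast, map_sub, hbz, sub_zero, hm]

end AbelJacobi

/-! ### Piecewise linear functions with prescribed bends -/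

section Bends

theorem IsIntegralPL.zsmul {l : ℝ} {f : ℝ → ℝ} (hf : IsIntegralPL l f) (n : ℤ) :
    IsIntegralPL l (fun t => n * f t) := by
  obtain ⟨B, hB⟩ := hf
  refine ⟨B, fun a b h0 hab hl hx => ?_⟩
  obtain ⟨m, hm⟩ := hB a b h0 hab hl hx
  exact ⟨n * m, fun t ht => by simp only [hm t ht]; push_cast; ring⟩

theorem isIntegralPL_affine (l c : ℝ) (m : ℤ) : IsIntegralPL l (fun t => c + m * t) :=
  ⟨∅, fun a _ _ _ _ _ => ⟨m, fun t _ => by ring⟩⟩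

theorem isIntegralPL_min (l s : ℝ) : IsIntegralPL l (fun t => min t s) := by
  refine ⟨{s}, fun a b _ _ _ hx => ?_⟩
  have hs := hx s (Finset.mem_singleton_self s)
  by_cases h : s ≤ a
  · exact ⟨0, fun t ht => by beta_reduce; rw [min_eq_right (h.trans ht.1), min_eq_right h]; simp⟩
  · have hb : b ≤ s := by
      by_contra hb
      exact hs ⟨not_le.1 h, not_le.1 hb⟩
    exact ⟨1, fun t ht => by
      beta_reduce
      rw [min_eq_left (ht.2.trans hb), min_eq_left (not_le.1 h).le]; simp⟩

theorem derivWithin_Icc_right_of_affine {f : ℝ → ℝ} {b c l y k : ℝ} (hbc : b < c) (hcl : c ≤ l)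
    (hf : ∀ t ∈ Icc b c, f t = y + k * (t - b)) : derivWithin f (Icc b l) b = k := by
  have h1 : HasDerivWithinAt (fun t => y + k * (t - b)) k (Icc b l) b := by
    simpa using (((hasDerivAt_id b).sub_const b).const_mul k).const_add y |>.hasDerivWithinAt
  refine (h1.congr_of_eventuallyEq ?_ (hf b ⟨le_rfl, hbc.le⟩)).derivWithin
    (uniqueDiffOn_Icc (hbc.trans_le hcl) b ⟨le_rfl, hbc.le.trans hcl⟩)
  filter_upwards [mem_nhdsWithin_of_mem_nhds (Iio_mem_nhds hbc), self_mem_nhdsWithin] with t ht ht'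
  exact hf t ⟨ht'.1, le_of_lt ht⟩

theorem derivWithin_Icc_left_of_affine {f : ℝ → ℝ} {a b y k : ℝ} (h0 : 0 ≤ a) (hab : a < b)
    (hf : ∀ t ∈ Icc a b, f t = y + k * (t - a)) : derivWithin f (Icc 0 b) b = k := by
  have h1 : HasDerivWithinAt (fun t => y + k * (t - a)) k (Icc 0 b) b := by
    simpa using (((hasDerivAt_id b).sub_const a).const_mul k).const_add y |>.hasDerivWithinAt
  refine (h1.congr_of_eventuallyEq ?_ (hf b ⟨hab.le, le_rfl⟩)).derivWithin
    (uniqueDiffOn_Icc (h0.trans_lt hab) b ⟨h0.trans hab.le, le_rfl⟩)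
  filter_upwards [mem_nhdsWithin_of_mem_nhds (Ioi_mem_nhds hab), self_mem_nhdsWithin] with t ht ht'
  exact hf t ⟨le_of_lt ht, ht'.2⟩

/-- A piecewise linear function without bends is affine: breakpoints at which the one-sided slopes
agree can be discarded one at a time. -/
theorem IsIntegralPL.affine_of_slopes_eq {l : ℝ} (hl : 0 < l) {f : ℝ → ℝ} (hf : IsIntegralPL l f)
    (h : ∀ t, 0 < t → t < l → derivWithin f (Icc 0 t) t = derivWithin f (Icc t l) t) :
    ∃ m : ℤ, ∀ t ∈ Icc 0 l, f t = f 0 + m * t := by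
  obtain ⟨B, hB⟩ := hf
  suffices H : ∀ B : Finset ℝ, (∀ a b : ℝ, 0 ≤ a → a < b → b ≤ l → (∀ x ∈ B, x ∉ Ioo a b) →
      ∃ m : ℤ, ∀ t ∈ Icc a b, f t = f a + m * (t - a)) →
      ∃ m : ℤ, ∀ t ∈ Icc 0 l, f t = f 0 + m * t from H B hB
  intro B
  induction B using Finset.induction_on with
  | empty =>
    intro hB
    obtain ⟨m, hm⟩ := hB 0 l le_rfl hl le_rfl (by simp)
    exact ⟨m, fun t ht => by simpa using hm t ht⟩
  | insert x B _ ih =>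
    intro hB
    refine ih fun a b h0 hab hbl hx => ?_
    by_cases hxab : x ∈ Ioo a b
    · obtain ⟨m, hm⟩ := hB a x h0 hxab.1 (hxab.2.le.trans hbl) fun y hy hy' => by
        rcases Finset.mem_insert.1 hy with rfl | hy
        · exact lt_irrefl _ hy'.2
        · exact hx y hy ⟨hy'.1, hy'.2.trans hxab.2⟩
      obtain ⟨m', hm'⟩ := hB x b (h0.trans hxab.1.le) hxab.2 hbl fun y hy hy' => by
        rcases Finset.mem_insert.1 hy with rfl | hy
        · exact lt_irrefl _ hy'.1
        · exact hx y hy ⟨hxab.1.trans hy'.1, hy'.2⟩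
      have h1 := h x (h0.trans_lt hxab.1) (hxab.2.trans_le hbl)
      rw [derivWithin_Icc_left_of_affine h0 hxab.1 hm,
        derivWithin_Icc_right_of_affine hxab.2 hbl hm'] at h1
      refine ⟨m, fun t ht => ?_⟩
      rcases le_total t x with htx | htx
      · exact hm t ⟨ht.1, htx⟩
      · rw [hm' t ⟨htx, ht.2⟩, hm x ⟨hxab.1.le, le_rfl⟩, ← h1]
        ring
    · refine hB a b h0 hab hbl fun y hy => ?_
      rcases Finset.mem_insert.1 hy with rfl | hy
      · exact hxab
      · exact hx y hy

variable {V E : Type*} {Γ : MetricGraph V E} [DecidableEq E]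

/-- The function `min t s` of the position `t` on the edge `e`, for a point at position `s` on the
same edge: it bends by one at `s` and is flat after `s`. -/
def bendFun (e : E) (t : ℝ) : Γ.Point → ℝ
  | .vertex _ => 0
  | .inner e' s _ _ => if e' = e then min t s else 0

/-- The indicator function of the points of `e` after the position `t`. -/
def afterIndicator (e : E) (t : ℝ) : Γ.Point → ℝ
  | .vertex _ => 0
  | .inner e' s _ _ => if e' = e ∧ t < s then 1 else 0

/-- The indicator function of the points of `e` at or after the position `t`. -/
def fromIndicator (e : E) (t : ℝ) : Γ.Point → ℝ
  | .vertex _ => 0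
  | .inner e' s _ _ => if e' = e ∧ t ≤ s then 1 else 0

/-- The piecewise linear function on `e` whose bends are prescribed by `D` and which vanishes
at `0` and is flat at the end of `e`. -/
def bend (D : Γ.Divisor) (e : E) (t : ℝ) : ℝ := weight (bendFun e t) D

theorem bend_add (D D' : Γ.Divisor) (e : E) (t : ℝ) :
    bend (D + D') e t = bend D e t + bend D' e t := map_add _ _ _

theorem bend_zero_eq (e : E) : bend (0 : Γ.Divisor) e = fun _ => 0 :=
  funext fun _ => map_zero _

theorem bend_add_eq (D D' : Γ.Divisor) (e : E) :
    bend (D + D') e = fun t => bend D e t + bend D' e t := funext fun t => bend_add D D' e t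

theorem bend_single (p : Γ.Point) (n : ℤ) (e : E) (t : ℝ) :
    bend (Finsupp.single p n) e t = n * bendFun e t p := by
  simp [bend, weight_single]

theorem bend_zero_right (D : Γ.Divisor) (e : E) : bend D e 0 = 0 := by
  induction D using Finsupp.induction_linear with
  | zero => simp [bend]
  | add D D' h h' => rw [bend_add, h, h', add_zero]
  | single p n =>
    rw [bend_single]
    cases p with
    | vertex v => simp [bendFun]
    | inner e' s h0 h1 => simp [bendFun, min_eq_left h0.le]

theorem bend_len (D : Γ.Divisor) (e : E) : bend D e (Γ.len e) = edgeMoment e D := by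
  induction D using Finsupp.induction_linear with
  | zero => simp [bend]
  | add D D' h h' => rw [bend_add, h, h', map_add]
  | single p n =>
    rw [bend_single, edgeMoment, weight_single, zsmul_eq_mul]
    cases p with
    | vertex v => simp [bendFun, edgePosition]
    | inner e' s h0 h1 =>
      by_cases he : e' = e
      · subst he; simp [bendFun, edgePosition, min_eq_right h1.le]
      · simp [bendFun, edgePosition, he]

theorem isIntegralPL_bend (l : ℝ) (D : Γ.Divisor) (e : E) : IsIntegralPL l (bend D e) := by
  induction D using Finsupp.induction_linear with
  | zero => rw [bend_zero_eq]; exact IsIntegralPL.zero l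
  | add D D' h h' => rw [bend_add_eq]; exact h.add h'
  | single p n =>
    have : bend (Finsupp.single p n) e = fun t => (n : ℝ) * bendFun e t p :=
      funext fun t => bend_single p n e t
    rw [this]
    cases p with
    | vertex v => simpa [bendFun] using IsIntegralPL.zero l
    | inner e' s h0 h1 =>
      by_cases he : e' = e
      · simpa [bendFun, he] using (isIntegralPL_min l s).zsmul n
      · simpa [bendFun, he] using IsIntegralPL.zero l

theorem hasDerivWithinAt_bend_right (D : Γ.Divisor) (e : E) (t l : ℝ) :
    HasDerivWithinAt (bend D e) (weight (afterIndicator e t) D) (Icc t l) t := by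
  induction D using Finsupp.induction_linear with
  | zero => rw [bend_zero_eq, map_zero]; exact hasDerivWithinAt_const _ _ _
  | add D D' h h' => rw [bend_add_eq, map_add]; exact h.add h'
  | single p n =>
    have : bend (Finsupp.single p n) e = fun t => (n : ℝ) * bendFun e t p :=
      funext fun t => bend_single p n e t
    rw [this, weight_single, zsmul_eq_mul]
    refine HasDerivWithinAt.const_mul _ ?_
    cases p with
    | vertex v => exact hasDerivWithinAt_const _ _ _
    | inner e' s h0 h1 =>
      by_cases he : e' = e
      · by_cases hs : t < s
        · simp only [bendFun, afterIndicator, he, hs, and_self, if_true]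
          refine ((hasDerivAt_id t).congr_of_eventuallyEq ?_).hasDerivWithinAt
          filter_upwards [Iio_mem_nhds hs] with x hx
          exact min_eq_left (le_of_lt hx)
        · simp only [bendFun, afterIndicator, he, hs, and_false, if_true, if_false]
          refine (hasDerivWithinAt_const t (Icc t l) s).congr (fun x hx => ?_) ?_
          · exact min_eq_right ((not_lt.1 hs).trans hx.1)
          · exact min_eq_right (not_lt.1 hs)
      · simp only [bendFun, afterIndicator, he, false_and, if_false]
        exact hasDerivWithinAt_const _ _ _

theorem hasDerivWithinAt_bend_left (D : Γ.Divisor) (e : E) (t : ℝ) :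
    HasDerivWithinAt (bend D e) (weight (fromIndicator e t) D) (Icc 0 t) t := by
  induction D using Finsupp.induction_linear with
  | zero => rw [bend_zero_eq, map_zero]; exact hasDerivWithinAt_const _ _ _
  | add D D' h h' => rw [bend_add_eq, map_add]; exact h.add h'
  | single p n =>
    have : bend (Finsupp.single p n) e = fun t => (n : ℝ) * bendFun e t p :=
      funext fun t => bend_single p n e t
    rw [this, weight_single, zsmul_eq_mul]
    refine HasDerivWithinAt.const_mul _ ?_
    cases p with
    | vertex v => exact hasDerivWithinAt_const _ _ _
    | inner e' s h0 h1 =>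
      by_cases he : e' = e
      · by_cases hs : t ≤ s
        · simp only [bendFun, fromIndicator, he, hs, and_self, if_true]
          refine (hasDerivWithinAt_id t (Icc 0 t)).congr (fun x hx => ?_) ?_
          · exact min_eq_left (hx.2.trans hs)
          · exact min_eq_left hs
        · simp only [bendFun, fromIndicator, he, hs, and_false, if_true, if_false]
          refine ((hasDerivAt_const t s).congr_of_eventuallyEq ?_).hasDerivWithinAt
          filter_upwards [Ioi_mem_nhds (not_le.1 hs)] with x hx
          exact min_eq_right (le_of_lt hx)
      · simp only [bendFun, fromIndicator, he, false_and, if_false]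
        exact hasDerivWithinAt_const _ _ _

theorem weight_fromIndicator_sub (D : Γ.Divisor) (e : E) (t : ℝ) (h0 : 0 < t)
    (h1 : t < Γ.len e) :
    weight (fromIndicator e t) D - weight (afterIndicator e t) D = D (.inner e t h0 h1) := by
  induction D using Finsupp.induction_linear with
  | zero => simp
  | add D D' h h' =>
    rw [Finsupp.add_apply, map_add, map_add, Int.cast_add, ← h, ← h']
    ring
  | single p n =>
    rw [weight_single, weight_single, ← smul_sub, zsmul_eq_mul]
    by_cases hp : p = .inner e t h0 h1
    · subst hp; simp [fromIndicator, afterIndicator]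
    · rw [Finsupp.single_eq_of_ne' hp]
      cases p with
      | vertex v => simp [fromIndicator, afterIndicator]
      | inner e' s h0' h1' =>
        by_cases he : e' = e
        · subst he
          have hs : t ≠ s := by rintro rfl; exact hp rfl
          simp [fromIndicator, afterIndicator, hs.le_iff_lt]
        · simp [fromIndicator, afterIndicator, he]

theorem weight_afterIndicator_zero (D : Γ.Divisor) (e : E) :
    weight (afterIndicator e 0) D = edgeDegree e D := by
  induction D using Finsupp.induction_linear with
  | zero => simp
  | add D D' h h' => rw [map_add, map_add, h, h', Int.cast_add]
  | single p n =>
    rw [edgeDegree, weight_single, weight_single]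
    cases p with
    | vertex v => simp [afterIndicator, edgeIndicator]
    | inner e' s h0 h1 => simp [afterIndicator, edgeIndicator, h0]

theorem weight_fromIndicator_len (D : Γ.Divisor) (e : E) :
    weight (fromIndicator e (Γ.len e)) D = 0 := by
  induction D using Finsupp.induction_linear with
  | zero => simp
  | add D D' h h' => rw [map_add, h, h', add_zero]
  | single p n =>
    rw [weight_single]
    cases p with
    | vertex v => simp [fromIndicator]
    | inner e' s h0 h1 =>
      have : ¬ (e' = e ∧ Γ.len e ≤ s) := by
        rintro ⟨rfl, h⟩
        exact absurd h1 (not_lt.2 h)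
      simp [fromIndicator, this]

end Bends

/-! ### Linear equivalence and potentials -/

section LinEquiv

variable {V E : Type*} {Γ : MetricGraph V E} [DecidableEq E]

theorem slopeRight_of_bend {φ : Γ.Point → ℝ} {D : Γ.Divisor} {e : E} {c : ℝ} {m : ℤ}
    (hφ : ∀ t ∈ Icc 0 (Γ.len e), φ (Γ.edgePoint e t) = c + m * t + bend D e t)
    {t : ℝ} (h0 : 0 ≤ t) (h1 : t < Γ.len e) :
    Γ.slopeRight φ e t = m + weight (afterIndicator e t) D := by
  have h2 : HasDerivWithinAt (fun t => c + m * t + bend D e t)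
      (m + weight (afterIndicator e t) D) (Icc t (Γ.len e)) t := by
    refine HasDerivWithinAt.add ?_ (hasDerivWithinAt_bend_right D e t _)
    simpa using ((hasDerivAt_id t).const_mul (m : ℝ)).const_add c |>.hasDerivWithinAt
  exact (h2.congr (fun x hx => hφ x ⟨h0.trans hx.1, hx.2⟩) (hφ t ⟨h0, h1.le⟩)).derivWithin
    (uniqueDiffOn_Icc h1 t ⟨le_rfl, h1.le⟩)

theorem slopeLeft_of_bend {φ : Γ.Point → ℝ} {D : Γ.Divisor} {e : E} {c : ℝ} {m : ℤ}
    (hφ : ∀ t ∈ Icc 0 (Γ.len e), φ (Γ.edgePoint e t) = c + m * t + bend D e t)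
    {t : ℝ} (h0 : 0 < t) (h1 : t ≤ Γ.len e) :
    Γ.slopeLeft φ e t = m + weight (fromIndicator e t) D := by
  have h2 : HasDerivWithinAt (fun t => c + m * t + bend D e t)
      (m + weight (fromIndicator e t) D) (Icc 0 t) t := by
    refine HasDerivWithinAt.add ?_ (hasDerivWithinAt_bend_left D e t)
    simpa using ((hasDerivAt_id t).const_mul (m : ℝ)).const_add c |>.hasDerivWithinAt
  exact (h2.congr (fun x hx => hφ x ⟨hx.1, hx.2.trans h1⟩) (hφ t ⟨h0.le, h1⟩)).derivWithin
    (uniqueDiffOn_Icc h0 t ⟨h0.le, le_rfl⟩)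

variable [Fintype E] [DecidableEq V]

theorem ord_vertex_of_bend {φ : Γ.Point → ℝ} {D : Γ.Divisor} {c : E → ℝ} {m : E → ℤ}
    (hφ : ∀ e, ∀ t ∈ Icc 0 (Γ.len e), φ (Γ.edgePoint e t) = c e + m e * t + bend D e t) (v : V) :
    Γ.ord φ (.vertex v) = Γ.boundary (fun e => (m e : ℝ)) v
      - ((footDegree v D - D (.vertex v) : ℤ) : ℝ) := by
  simp only [ord, slopeLeft_of_bend (hφ _) (Γ.len_pos _) le_rfl,
    slopeRight_of_bend (hφ _) le_rfl (Γ.len_pos _), weight_fromIndicator_len,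
    weight_afterIndicator_zero, add_zero, boundary, LinearMap.coe_mk, AddHom.coe_mk, footDegree,
    add_sub_cancel_left, Int.cast_sum]
  rw [← Finset.sum_sub_distrib, ← Finset.sum_sub_distrib]
  refine Finset.sum_congr rfl fun e _ => ?_
  split_ifs <;> push_cast <;> ring

theorem ord_inner_of_bend {φ : Γ.Point → ℝ} {D : Γ.Divisor} {e : E} {c : ℝ} {m : ℤ}
    (hφ : ∀ t ∈ Icc 0 (Γ.len e), φ (Γ.edgePoint e t) = c + m * t + bend D e t)
    {t : ℝ} (h0 : 0 < t) (h1 : t < Γ.len e) :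
    Γ.ord φ (.inner e t h0 h1) = D (.inner e t h0 h1) := by
  rw [← weight_fromIndicator_sub, ord, slopeLeft_of_bend hφ h0 h1.le,
    slopeRight_of_bend hφ h0.le h1]
  ring

theorem HasPotential.linEquiv {D₁ D₂ : Γ.Divisor} (h : HasPotential (D₁ - D₂)) :
    D₁.LinEquiv D₂ := by
  obtain ⟨f, m, h1, h2⟩ := h
  let φ : Γ.Point → ℝ
    | .vertex v => f v
    | .inner e t _ _ => f (Γ.src e) + m e * t + bend (D₁ - D₂) e t
  have hφ : ∀ e, ∀ t ∈ Icc 0 (Γ.len e),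
      φ (Γ.edgePoint e t) = f (Γ.src e) + m e * t + bend (D₁ - D₂) e t := by
    intro e t ht
    rcases ht.1.eq_or_lt with rfl | h0
    · rw [edgePoint_zero, bend_zero_right]
      simp [φ]
    · rcases ht.2.eq_or_lt with rfl | hl
      · rw [edgePoint_len, bend_len]
        have := h1 e
        simp only [φ]
        linarith
      · rw [edgePoint_inner e h0 hl]
  refine ⟨φ, fun e => ?_, fun p => ?_⟩
  · obtain ⟨B, hB⟩ := (isIntegralPL_affine (Γ.len e) (f (Γ.src e)) (m e)).add
      (isIntegralPL_bend (Γ.len e) (D₁ - D₂) e)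
    refine ⟨B, fun a b h0 hab hbl hx => ?_⟩
    obtain ⟨k, hk⟩ := hB a b h0 hab hbl hx
    refine ⟨k, fun t ht => ?_⟩
    beta_reduce
    rw [hφ e t ⟨h0.trans ht.1, ht.2.trans hbl⟩, hφ e a ⟨h0, hab.le.trans hbl⟩]
    exact hk t ht
  · cases p with
    | vertex v =>
      rw [ord_vertex_of_bend hφ, ← h2 v, Finsupp.sub_apply]
      push_cast
      ring
    | inner e t h0 h1 => rw [ord_inner_of_bend (hφ e) h0 h1, Finsupp.sub_apply]

theorem Divisor.LinEquiv.hasPotential {D₁ D₂ : Γ.Divisor} (h : D₁.LinEquiv D₂) :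
    HasPotential (D₁ - D₂) := by
  obtain ⟨φ, hφ, hord⟩ := h
  set D : Γ.Divisor := D₁ - D₂ with hD
  have hord' : ∀ p, (D p : ℝ) = Γ.ord φ p := fun p => by rw [← hord, hD, Finsupp.sub_apply]
  -- After subtraction of the bends prescribed by `D`, the restriction of `φ` to an edge is affine.
  have key : ∀ e, ∃ m : ℤ, ∀ t ∈ Icc 0 (Γ.len e),
      φ (Γ.edgePoint e t) = φ (.vertex (Γ.src e)) + m * t + bend D e t := by
    intro e
    have hPL : IsIntegralPL (Γ.len e) (fun t => φ (Γ.edgePoint e t) + - bend D e t) :=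
      (hφ e).add (isIntegralPL_bend _ D e).neg
    obtain ⟨m, hm⟩ := hPL.affine_of_slopes_eq (Γ.len_pos e) fun t h0 h1 => by
      have hr : HasDerivWithinAt (fun t => φ (Γ.edgePoint e t) + - bend D e t)
          (Γ.slopeRight φ e t + - weight (afterIndicator e t) D) (Icc t (Γ.len e)) t :=
        ((hφ e).differentiableRight h0.le h1).hasDerivWithinAt.add
          (hasDerivWithinAt_bend_right D e t _).neg
      have hl : HasDerivWithinAt (fun t => φ (Γ.edgePoint e t) + - bend D e t)
          (Γ.slopeLeft φ e t + - weight (fromIndicator e t) D) (Icc 0 t) t :=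
        ((hφ e).differentiableLeft h0 h1.le).hasDerivWithinAt.add
          (hasDerivWithinAt_bend_left D e t).neg
      rw [hr.derivWithin (uniqueDiffOn_Icc h1 t ⟨le_rfl, h1.le⟩),
        hl.derivWithin (uniqueDiffOn_Icc h0 t ⟨h0.le, le_rfl⟩)]
      have h2 := hord' (.inner e t h0 h1)
      rw [← weight_fromIndicator_sub, ord] at h2
      linarith
    refine ⟨m, fun t ht => ?_⟩
    have h2 := hm t ht
    rw [edgePoint_zero, bend_zero_right] at h2
    linarith
  choose m hm using key
  refine ⟨fun v => φ (.vertex v), m, fun e => ?_, fun v => ?_⟩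
  · have h1 := hm e (Γ.len e) ⟨(Γ.len_pos e).le, le_rfl⟩
    rw [edgePoint_len, bend_len] at h1
    linarith
  · have h1 := hord' (.vertex v)
    rw [ord_vertex_of_bend hm] at h1
    push_cast at h1
    linarith

variable [Fintype V]

/-- Abel's theorem: linearly equivalent divisors have the same image in the Jacobian. -/
theorem Divisor.LinEquiv.ajHom_eq {D₁ D₂ : Γ.Divisor} (h : D₁.LinEquiv D₂) (q : Γ.Point) :
    ajHom q D₁ = ajHom q D₂ := by
  rw [← sub_eq_zero, ← map_sub]
  exact h.hasPotential.ajHom_eq_zero q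

theorem Divisor.LinEquiv.degree_eq {D₁ D₂ : Γ.Divisor} (h : D₁.LinEquiv D₂) :
    D₁.degree = D₂.degree := by
  rw [← sub_eq_zero, ← degree_sub]
  exact h.hasPotential.degree_eq_zero

/-- The converse of Abel's theorem: divisors of the same degree with the same image in the Jacobian
are linearly equivalent. -/
theorem linEquiv_of_ajHom_eq {D₁ D₂ : Γ.Divisor} (hdeg : D₁.degree = D₂.degree) (q : Γ.Point)
    (h : ajHom q D₁ = ajHom q D₂) : D₁.LinEquiv D₂ :=
  (hasPotential_of_ajHom_eq_zero (by rw [degree_sub, hdeg, sub_self]) q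
    (by rw [map_sub, h, sub_self])).linEquiv

end LinEquiv

/-! ### Rigid divisors -/

section Rigid

variable {V E : Type*} {Γ : MetricGraph V E}

theorem weight_nonneg {A : Type*} [AddCommGroup A] [PartialOrder A] [IsOrderedAddMonoid A]
    {w : Γ.Point → A} (hw : ∀ p, 0 ≤ w p) {D : Γ.Divisor} (hD : D.IsEffective) :
    0 ≤ weight w D := by
  simp only [weight, Finsupp.liftAddHom_apply, Finsupp.sum, zmultiplesHom_apply]
  exact Finset.sum_nonneg fun p _ => zsmul_nonneg (hw p) (hD p)

theorem Divisor.IsEffective.degree_nonneg {D : Γ.Divisor} (hD : D.IsEffective) :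
    0 ≤ D.degree := by
  rw [degree_eq_weight]
  exact weight_nonneg (fun _ => zero_le_one) hD

theorem Divisor.IsEffective.add {D D' : Γ.Divisor} (hD : D.IsEffective) (hD' : D'.IsEffective) :
    Divisor.IsEffective (D + D') := fun p => add_nonneg (hD p) (hD' p)

theorem isEffective_single (p : Γ.Point) {n : ℤ} (hn : 0 ≤ n) :
    Divisor.IsEffective (Γ := Γ) (Finsupp.single p n) := by
  classical
  intro p'
  rw [Finsupp.single_apply]
  split_ifs <;> simp [hn]

theorem isEffective_zero : Divisor.IsEffective (0 : Γ.Divisor) := fun _ => le_rfl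

/-- An effective divisor of positive degree has a point. -/
theorem Divisor.IsEffective.exists_eq_add {D : Γ.Divisor} (hD : D.IsEffective)
    (hdeg : 0 < D.degree) :
    ∃ (p : Γ.Point) (D' : Γ.Divisor), D'.IsEffective ∧ D = D' + Finsupp.single p 1 := by
  classical
  obtain ⟨p, hp⟩ : ∃ p, 0 < D p := by
    by_contra hne
    push Not at hne
    have : D = 0 := Finsupp.ext fun p => le_antisymm (hne p) (hD p)
    subst this
    simp [Divisor.degree] at hdeg
  refine ⟨p, D - Finsupp.single p 1, fun p' => ?_, (sub_add_cancel _ _).symm⟩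
  rw [Finsupp.sub_apply, Finsupp.single_apply]
  split_ifs with h
  · subst h; lia
  · simpa using hD p'

theorem Divisor.IsEffective.eq_zero {D : Γ.Divisor} (hD : D.IsEffective) (hdeg : D.degree = 0) :
    D = 0 := by
  ext p
  by_contra hp
  have hp' : 0 < D p := lt_of_le_of_ne (hD p) (Ne.symm hp)
  have h1 : D p ≤ D.degree :=
    Finset.single_le_sum (f := fun p => D p) (fun p _ => hD p) (Finsupp.mem_support_iff.2 hp)
  lia

/-- The divisor with one point on each edge `e ∈ F`, at the fraction `t e` of its length. -/
def edgeDivisor (Γ : MetricGraph V E) (F : Finset E) (t : E → ℝ) : Γ.Divisor :=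
  ∑ e ∈ F, Finsupp.single (Γ.edgePoint e (t e * Γ.len e)) 1

theorem edgeDivisor_isEffective (F : Finset E) (t : E → ℝ) :
    (Γ.edgeDivisor F t).IsEffective := fun p => by
  rw [edgeDivisor, Finsupp.finsetSum_apply]
  exact Finset.sum_nonneg fun e _ => isEffective_single _ zero_le_one p

theorem edgeDivisor_degree (F : Finset E) (t : E → ℝ) :
    (Γ.edgeDivisor F t).degree = F.card := by
  rw [degree_eq_weight, edgeDivisor, map_sum]
  simp [weight_single]

variable [DecidableEq E]

theorem edgeMoment_le {D : Γ.Divisor} (hD : D.IsEffective) (e : E) :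
    edgeMoment e D ≤ edgeDegree e D * Γ.len e := by
  have h : ∀ D : Γ.Divisor, weight (fun p => (edgeIndicator e p : ℝ) * Γ.len e - edgePosition e p) D
      = edgeDegree e D * Γ.len e - edgeMoment e D := by
    intro D
    induction D using Finsupp.induction_linear with
    | zero => simp
    | add D D' h h' => simp only [map_add, h, h', Int.cast_add]; ring
    | single p n => simp only [edgeMoment, edgeDegree, weight_single, zsmul_eq_mul, Int.cast_mul,
        smul_eq_mul]; ring
  rw [← sub_nonneg, ← h]
  refine weight_nonneg (fun p => ?_) hD
  cases p with
  | vertex v => simp [edgeIndicator, edgePosition]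
  | inner e' t h0 h1 =>
    by_cases he : e' = e
    · subst he; simp [edgeIndicator, edgePosition, h1.le]
    · simp [edgeIndicator, edgePosition, he]

theorem edgeMoment_nonneg {D : Γ.Divisor} (hD : D.IsEffective) (e : E) : 0 ≤ edgeMoment e D := by
  refine weight_nonneg (fun p => ?_) hD
  cases p with
  | vertex v => exact le_rfl
  | inner e' t h0 h1 => simp only [edgePosition]; split_ifs <;> simp [h0.le]

variable [Fintype E] [DecidableEq V] [Fintype V]

/-- A divisor `R` that has one point in the interior of each edge of a coconnected set and no other
points is not equivalent to an effective divisor with a vertex in its support.  At a vertex where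
the potential `f` is minimal all incoming slopes are at most zero, although they add up to the
nonnegative coefficient of `D'`; so they vanish, and `f` does not change along the edges outside `F`
that end there.  As these edges connect all the vertices, `f` is minimal everywhere. -/
theorem IsCoconnected.apply_vertex_eq_zero {F : Finset E} (hF : Γ.IsCoconnected F)
    {R D' : Γ.Divisor} (hR : ∀ v, R (.vertex v) = 0)
    (hdeg : ∀ e, edgeDegree e R = if e ∈ F then 1 else 0)
    (hpos : ∀ e ∈ F, 0 < edgeMoment e R) (hlen : ∀ e, edgeMoment e R < Γ.len e)
    (hzero : ∀ e ∉ F, edgeMoment e R = 0) (hD' : D'.IsEffective) (h : HasPotential (D' - R))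
    (v : V) : D' (.vertex v) = 0 := by
  obtain ⟨f, m, h1, h2⟩ := h
  -- The initial slopes on the edges.
  let α : E → ℤ := fun e => m e + edgeDegree e D' - edgeDegree e R
  have hord : ∀ v, D' (.vertex v)
      = ∑ e, ((if Γ.tgt e = v then m e else 0) - if Γ.src e = v then α e else 0) := by
    intro v
    have h3 : footDegree v (D' - R) = ∑ e, m e * ((if Γ.tgt e = v then 1 else 0)
        - if Γ.src e = v then 1 else 0) := by
      have h4 := h2 v
      simp only [boundary, LinearMap.coe_mk, AddHom.coe_mk] at h4
      exact_mod_cast h4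
    rw [footDegree, Finsupp.sub_apply, hR, sub_zero] at h3
    rw [eq_sub_of_add_eq h3, ← Finset.sum_sub_distrib]
    refine Finset.sum_congr rfl fun e _ => ?_
    simp only [α, map_sub]
    split_ifs <;> ring
  obtain ⟨v₀⟩ := Γ.nonempty
  obtain ⟨w, -, hw⟩ := Finset.exists_min_image Finset.univ f ⟨v₀, Finset.mem_univ v₀⟩
  have hw' : ∀ v, f w ≤ f v := fun v => hw v (Finset.mem_univ v)
  have hlenpos := Γ.len_pos
  have hM0 := fun e => edgeMoment_nonneg hD' e
  have hM1 := fun e => edgeMoment_le hD' e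
  have hα : ∀ e, f (Γ.src e) = f w → 0 ≤ α e := by
    intro e he
    have h3 := h1 e
    rw [map_sub, he] at h3
    have h4 : 0 < ((α e + 1 : ℤ) : ℝ) * Γ.len e := by
      have h5 := hw' (Γ.tgt e)
      by_cases heF : e ∈ F
      · have h6 := hpos e heF
        have h7 : α e + 1 = m e + edgeDegree e D' := by simp [α, hdeg, heF]
        rw [h7]; push_cast
        nlinarith [hM1 e]
      · have h6 := hzero e heF
        have h7 : α e = m e + edgeDegree e D' := by simp [α, hdeg, heF]
        rw [h7]; push_cast
        nlinarith [hM1 e, hlenpos e]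
    have h5 : (0 : ℝ) < ((α e + 1 : ℤ) : ℝ) := pos_of_mul_pos_left h4 (hlenpos e).le
    have h6 : 0 < α e + 1 := by exact_mod_cast h5
    lia
  have hm : ∀ e, f (Γ.tgt e) = f w → m e ≤ 0 := by
    intro e he
    have h3 := h1 e
    rw [map_sub, he] at h3
    have h4 : 0 < ((1 - m e : ℤ) : ℝ) * Γ.len e := by
      push_cast
      nlinarith [hM0 e, hlen e, hw' (Γ.src e)]
    have h5 : (0 : ℝ) < ((1 - m e : ℤ) : ℝ) := pos_of_mul_pos_left h4 (hlenpos e).le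
    have h6 : 0 < 1 - m e := by exact_mod_cast h5
    lia
  have hterm : ∀ v, f v = f w → ∀ e,
      (if Γ.tgt e = v then m e else 0) - (if Γ.src e = v then α e else 0) ≤ 0 := by
    intro v hv e
    have h3 : Γ.tgt e = v → m e ≤ 0 := fun h => hm e (by rw [h, hv])
    have h4 : Γ.src e = v → 0 ≤ α e := fun h => hα e (by rw [h, hv])
    split_ifs <;> grind
  have hterm0 : ∀ v, f v = f w → ∀ e,
      (if Γ.tgt e = v then m e else 0) - (if Γ.src e = v then α e else 0) = 0 := by
    intro v hv e
    have h3 := hD' (.vertex v)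
    rw [hord v] at h3
    exact (Finset.sum_eq_zero_iff_of_nonpos fun e _ => hterm v hv e).1
      (le_antisymm (Finset.sum_nonpos fun e _ => hterm v hv e) h3) e (Finset.mem_univ e)
  have hmin : ∀ u, f u = f w := by
    intro u
    by_contra hu
    obtain ⟨e, he, hc⟩ := hF {v | f v = f w} ⟨w, rfl⟩ fun h => hu (eq_univ_iff_forall.1 h u)
    have h3 := h1 e
    rw [map_sub, hzero e he] at h3
    simp only [Crosses, mem_ofPred_eq] at hc
    by_cases hs : f (Γ.src e) = f w
    · have ht : f (Γ.tgt e) ≠ f w := fun ht => hc (by simp [hs, ht])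
      have hne : Γ.tgt e ≠ Γ.src e := fun h => ht (by rw [h, hs])
      have h4 := hterm0 _ hs e
      simp only [hne, if_false, if_true, zero_sub, neg_eq_zero] at h4
      simp only [α, hdeg, he, if_false, sub_zero] at h4
      have h5 : (m e : ℝ) + edgeDegree e D' = 0 := by exact_mod_cast h4
      refine ht (le_antisymm ?_ (hw' _))
      have h6 : (m e : ℝ) * Γ.len e + edgeDegree e D' * Γ.len e = 0 := by
        rw [← add_mul, h5, zero_mul]
      linarith [hM1 e]
    · have ht : f (Γ.tgt e) = f w := by tauto
      have hne : Γ.src e ≠ Γ.tgt e := fun h => hs (by rw [h, ht])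
      have h4 := hterm0 _ ht e
      simp only [hne, if_false, if_true, sub_zero] at h4
      rw [h4] at h3
      refine hs (le_antisymm ?_ (hw' _))
      push_cast at h3
      nlinarith [hM0 e]
  rw [hord v]
  exact Finset.sum_eq_zero fun e _ => hterm0 v (hmin v) e

theorem IsCoconnected.apply_vertex_eq_zero_of_linEquiv {F : Finset E} (hF : Γ.IsCoconnected F)
    {t : E → ℝ} (ht : ∀ e ∈ F, t e ∈ Ioo (0 : ℝ) 1) {D' : Γ.Divisor} (hD' : D'.IsEffective)
    (h : D'.LinEquiv (Γ.edgeDivisor F t)) (v : V) : D' (.vertex v) = 0 := by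
  have hp : ∀ e ∈ F, ∃ (h0 : 0 < t e * Γ.len e) (h1 : t e * Γ.len e < Γ.len e),
      Γ.edgePoint e (t e * Γ.len e) = .inner e _ h0 h1 := fun e he => by
    have h0 := mul_pos (ht e he).1 (Γ.len_pos e)
    have h1 : t e * Γ.len e < Γ.len e := by nlinarith [(ht e he).2, Γ.len_pos e]
    exact ⟨h0, h1, edgePoint_inner e h0 h1⟩
  have hM : ∀ e, edgeMoment e (Γ.edgeDivisor F t) = if e ∈ F then t e * Γ.len e else 0 := by
    intro e
    rw [edgeDivisor, map_sum, ← Finset.sum_ite_eq' F e (fun e => t e * Γ.len e)]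
    refine Finset.sum_congr rfl fun e' he' => ?_
    obtain ⟨h0, h1, h2⟩ := hp e' he'
    rw [h2, edgeMoment, weight_single]
    simp [edgePosition]
  refine hF.apply_vertex_eq_zero (R := Γ.edgeDivisor F t) (fun v => ?_) (fun e => ?_)
    (fun e he => ?_) (fun e => ?_) (fun e he => ?_) hD' h.hasPotential v
  · rw [edgeDivisor, Finsupp.finsetSum_apply]
    refine Finset.sum_eq_zero fun e he => ?_
    obtain ⟨h0, h1, h2⟩ := hp e he
    rw [h2, Finsupp.single_eq_of_ne (by simp)]
  · rw [edgeDivisor, map_sum, ← Finset.sum_ite_eq' F e (fun _ => (1 : ℤ))]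
    refine Finset.sum_congr rfl fun e' he' => ?_
    obtain ⟨h0, h1, h2⟩ := hp e' he'
    rw [h2, edgeDegree, weight_single]
    simp [edgeIndicator]
  · rw [hM, if_pos he]
    exact (hp e he).1
  · rw [hM]
    split_ifs with he
    · exact (hp e he).2.1
    · exact Γ.len_pos e
  · rw [hM, if_neg he]

end Rigid

/-! ### Separating vertex sets -/

section ChipMoves

variable {V E : Type*} {Γ : MetricGraph V E}

theorem Crosses.of_inter {Y Z : Set V} {e : E} (h : Γ.Crosses (Y ∩ Z) e) :
    Γ.Crosses Y e ∨ Γ.Crosses Z e := by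
  simp only [Crosses, mem_inter_iff] at *
  tauto

theorem Crosses.exists_other_end {Y : Set V} {e : E} {w : V} (hc : Γ.Crosses Y e)
    (hw : Γ.src e = w ∨ Γ.tgt e = w) (hwY : w ∉ Y) :
    ∃ u ∈ Y, ∀ Z : Set V, w ∉ Z → (Γ.Crosses Z e ↔ u ∈ Z) := by
  simp only [Crosses] at *
  rcases hw with rfl | rfl
  · exact ⟨Γ.tgt e, by tauto, fun Z hZ => by tauto⟩
  · exact ⟨Γ.src e, by tauto, fun Z hZ => by tauto⟩

/-- The vertex set `Y` contains `p` but not `w`, and the edges outside `F` that cross its cut all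
end at `w`. -/
def Separates (Γ : MetricGraph V E) (F : Finset E) (Y : Set V) (w p : V) : Prop :=
  p ∈ Y ∧ w ∉ Y ∧ ∀ e ∉ F, Γ.Crosses Y e → Γ.src e = w ∨ Γ.tgt e = w

theorem separates_compl_singleton {F : Finset E} {w p : V} (h : w ≠ p) :
    Γ.Separates F {w}ᶜ w p :=
  ⟨by simpa using h.symm, by simp, fun e _ hc => by
    simp only [Crosses, mem_compl_iff, mem_singleton_iff] at hc; tauto⟩

variable [DecidableEq E]

/-- If a minimal separating set is crossed by two edges outside `F`, then one of them can be added
to `F`. -/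
theorem IsCoconnected.insert_of_minimal {F : Finset E} (hF : Γ.IsCoconnected F) {Y : Set V}
    {w p : V} (hY : Γ.Separates F Y w p) (hmin : ∀ Y' ⊆ Y, Γ.Separates F Y' w p → Y' = Y)
    {h h' : E} (hh : h ∉ F) (hhY : Γ.Crosses Y h) (hh' : h' ∉ F) (hhY' : Γ.Crosses Y h')
    (hne : h' ≠ h) : Γ.IsCoconnected (insert h F) := by
  obtain ⟨hpY, hwY, hYw⟩ := hY
  suffices H : ∀ Z : Set V, Z.Nonempty → Z ≠ univ → w ∉ Z → ∃ e ∉ insert h F, Γ.Crosses Z e by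
    intro Z hZ hZ'
    by_cases hw : w ∈ Z
    · obtain ⟨e, he, hc⟩ := H Zᶜ (nonempty_compl.2 hZ')
        (fun h' => by simp [compl_univ_iff.1 h'] at hZ) (not_not.2 hw)
      exact ⟨e, he, crosses_compl.1 hc⟩
    · exact H Z hZ hZ' hw
  intro Z hZ hZ' hwZ
  by_contra hcon
  push Not at hcon
  have honly : ∀ e ∉ F, Γ.Crosses Z e → e = h := fun e he hc => by
    by_contra heh
    exact hcon e (by simp [heh, he]) hc
  have hhZ : Γ.Crosses Z h := by
    obtain ⟨e, he, hc⟩ := hF Z hZ hZ'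
    rwa [← honly e he hc]
  have hhw := hYw h hh hhY
  have hhw' := hYw h' hh' hhY'
  -- The separating sets `Y ∩ Z` or `Y ∩ Zᶜ` are all of `Y` by minimality.
  have hsep : ∀ Z' : Set V, (∀ e, Γ.Crosses Z' e → Γ.Crosses Z e) → p ∈ Z' → Y ⊆ Z' := by
    intro Z' hZZ' hpZ'
    refine inter_eq_left.1 (hmin _ inter_subset_left ⟨⟨hpY, hpZ'⟩, fun h'' => hwY h''.1, ?_⟩)
    intro e he hc
    rcases hc.of_inter with hc' | hc'
    · exact hYw e he hc'
    · rw [honly e he (hZZ' e hc')]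
      exact hhw
  by_cases hpZ : p ∈ Z
  · obtain ⟨u, huY, hu⟩ := hhY'.exists_other_end hhw' hwY
    exact hne (honly h' hh' ((hu Z hwZ).2 (hsep Z (fun _ => id) hpZ huY)))
  · obtain ⟨u, huY, hu⟩ := hhY.exists_other_end hhw hwY
    exact hsep Zᶜ (fun _ => crosses_compl.1) hpZ huY ((hu Z hwZ).1 hhZ)

/-! ### Chips on edges, and chips moving into a cut -/

theorem update_mem_Icc {F : Finset E} {t : E → ℝ} (ht : ∀ e ∈ F, t e ∈ Icc (0 : ℝ) 1) {h : E}
    {s : ℝ} (hs : s ∈ Icc (0 : ℝ) 1) :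
    ∀ e ∈ insert h F, Function.update t h s e ∈ Icc (0 : ℝ) 1 := by
  intro e he
  by_cases heh : e = h
  · subst heh; simpa using hs
  · rw [Function.update_of_ne heh]
    exact ht e (Finset.mem_of_mem_insert_of_ne he heh)

variable [Fintype E] [DecidableEq V]

/-- The Abel-Jacobi image of the point of `e` at the fraction `s` of its length. -/
def edgeClass (q : Γ.Point) (e : E) (s : ℝ) : Γ.Jac :=
  Γ.abelJacobi q (.vertex (Γ.src e)) + Γ.chainClass (Pi.single e s)

/-- The Abel-Jacobi image of a divisor with one point on each edge `e ∈ F`, at the fraction `t e`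
of its length. -/
def edgesClass (q : Γ.Point) (F : Finset E) (t : E → ℝ) : Γ.Jac := ∑ e ∈ F, edgeClass q e (t e)

theorem edgeClass_zero (q : Γ.Point) (e : E) :
    edgeClass q e 0 = Γ.abelJacobi q (.vertex (Γ.src e)) := by
  simp [edgeClass]

theorem edgeClass_one (q : Γ.Point) (e : E) :
    edgeClass q e 1 = Γ.abelJacobi q (.vertex (Γ.tgt e)) := by
  rw [edgeClass, abelJacobi_tgt]

theorem edgeClass_add (q : Γ.Point) (e : E) (s s' : ℝ) :
    edgeClass q e (s + s') = edgeClass q e s + Γ.chainClass (Pi.single e s') := by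
  rw [edgeClass, edgeClass, Pi.single_add, map_add, add_assoc]

theorem abelJacobi_inner (q : Γ.Point) (e : E) (t : ℝ) (h0 : 0 < t) (h1 : t < Γ.len e) :
    Γ.abelJacobi q (.inner e t h0 h1) = edgeClass q e (t / Γ.len e) :=
  abelJacobi_eq q _

theorem abelJacobi_edgePoint (q : Γ.Point) (e : E) {s : ℝ} (hs : s ∈ Icc (0 : ℝ) 1) :
    Γ.abelJacobi q (Γ.edgePoint e (s * Γ.len e)) = edgeClass q e s := by
  have hl := Γ.len_pos e
  rcases hs.1.eq_or_lt with rfl | h0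
  · rw [zero_mul, edgePoint_zero, edgeClass_zero]
  rcases hs.2.eq_or_lt with rfl | h1
  · rw [one_mul, edgePoint_len, edgeClass_one]
  rw [edgePoint_inner e (mul_pos h0 hl) (by nlinarith), abelJacobi_inner,
    mul_div_cancel_right₀ _ hl.ne']

theorem ajHom_edgeDivisor (q : Γ.Point) {F : Finset E} {t : E → ℝ}
    (ht : ∀ e ∈ F, t e ∈ Icc (0 : ℝ) 1) :
    ajHom q (Γ.edgeDivisor F t) = edgesClass q F t := by
  rw [edgeDivisor, map_sum, edgesClass]
  refine Finset.sum_congr rfl fun e he => ?_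
  rw [ajHom_single, one_smul, abelJacobi_edgePoint q e (ht e he)]

theorem edgesClass_insert (q : Γ.Point) {F : Finset E} {t : E → ℝ} {h : E} (hh : h ∉ F) (s : ℝ) :
    edgesClass q (insert h F) (Function.update t h s) = edgeClass q h s + edgesClass q F t := by
  rw [edgesClass, Finset.sum_insert hh, Function.update_self]
  congr 1
  exact Finset.sum_congr rfl fun e he => by
    rw [Function.update_of_ne (ne_of_mem_of_not_mem he hh)]

/-- The class of a chip at an end of `h` is that of a chip on `h`. -/
theorem exists_edgeClass_eq (q : Γ.Point) {h : E} {w : V} (hw : Γ.src h = w ∨ Γ.tgt h = w) :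
    ∃ s ∈ Icc (0 : ℝ) 1, edgeClass q h s = Γ.abelJacobi q (.vertex w) := by
  rcases hw with rfl | rfl
  · exact ⟨0, by simp, edgeClass_zero q h⟩
  · exact ⟨1, by simp, edgeClass_one q h⟩

variable [Fintype V]

/-- If each edge across the cut of `X` carries a chip, then these chips can be moved at equal speed
into `X`, without a change of the divisor class, until one of them arrives at a vertex of `X`. -/
theorem exists_move_into_cut (q : Γ.Point) {G : Finset E} {t : E → ℝ}
    (ht : ∀ e ∈ G, t e ∈ Icc (0 : ℝ) 1) {X : Set V} (hX : ∀ e, Γ.Crosses X e → e ∈ G)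
    (hne : ∃ e, Γ.Crosses X e) :
    ∃ j ∈ G, Γ.Crosses X j ∧ ∃ w ∈ X, (Γ.src j = w ∨ Γ.tgt j = w) ∧
      ∃ t' : E → ℝ, (∀ e ∈ G.erase j, t' e ∈ Icc (0 : ℝ) 1) ∧
        edgesClass q G t = Γ.abelJacobi q (.vertex w) + edgesClass q (G.erase j) t' := by
  classical
  obtain ⟨h, hh⟩ := hne
  have hcr : ∀ e, Γ.Crosses X e ↔
      (Γ.src e ∉ X ∧ Γ.tgt e ∈ X) ∨ (Γ.src e ∈ X ∧ Γ.tgt e ∉ X) := fun e => by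
    simp only [Crosses]; tauto
  let χ : V → ℝ := fun v => if v ∈ X then 1 else 0
  -- The time after which the chip on `e` arrives at the end of `e` in `X`.
  let τ : E → ℝ := fun e => Γ.len e * if Γ.tgt e ∈ X then 1 - t e else t e
  obtain ⟨j, hj, hmin⟩ := Finset.exists_min_image (G.filter fun e => Γ.Crosses X e) τ
    ⟨h, Finset.mem_filter.2 ⟨hX h hh, hh⟩⟩
  obtain ⟨hjG, hjX⟩ := Finset.mem_filter.1 hj
  have hmin' : ∀ e, Γ.Crosses X e → τ j ≤ τ e := fun e he =>
    hmin e (Finset.mem_filter.2 ⟨hX e he, he⟩)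
  have hl := Γ.len_pos
  have hτ : 0 ≤ τ j := by
    refine mul_nonneg (hl j).le ?_
    have := ht j hjG
    split_ifs
    · linarith [this.2]
    · exact this.1
  let x : E → ℝ := fun e => τ j * (χ (Γ.tgt e) - χ (Γ.src e)) / Γ.len e
  have hx0 : ∀ e, ¬ Γ.Crosses X e → x e = 0 := by
    intro e he
    simp only [Crosses, not_not] at he
    simp [x, χ, he]
  have hclass : edgesClass q G (fun e => t e + x e) = edgesClass q G t := by
    have h1 : Γ.chainClass x = 0 := by
      refine Γ.chainClass_eq_zero_of_potential x (fun v => τ j * χ v) fun e => ?_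
      simp only [x]
      rw [mul_div_cancel₀ _ (hl e).ne']
      ring
    have h2 : x = ∑ e ∈ G, Pi.single e (x e) := by
      funext e
      rw [Finset.sum_apply]
      by_cases he : e ∈ G
      · rw [Finset.sum_eq_single e (fun b _ hb => by simp [hb.symm]) (fun h' => absurd he h')]
        simp
      · rw [hx0 e fun h' => he (hX e h'), Finset.sum_eq_zero fun b hb => ?_]
        have : e ≠ b := fun h' => he (h' ▸ hb)
        simp [this]
    simp only [edgesClass, edgeClass_add, Finset.sum_add_distrib]
    rw [← map_sum, ← h2, h1, add_zero]
  have hmem : ∀ e ∈ G, t e + x e ∈ Icc (0 : ℝ) 1 := by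
    intro e he
    have hte := ht e he
    by_cases hc : Γ.Crosses X e
    · have h1 := hmin' e hc
      have hle := hl e
      have h3 : 0 ≤ τ j / Γ.len e := div_nonneg hτ hle.le
      rcases (hcr e).1 hc with ⟨hs, htg⟩ | ⟨hs, htg⟩
      · have h2 : τ j / Γ.len e ≤ 1 - t e := by
          rw [div_le_iff₀ hle, mul_comm]
          simpa [τ, htg] using h1
        have h4 : x e = τ j / Γ.len e := by simp [x, χ, hs, htg]
        rw [h4]
        exact ⟨by linarith [hte.1], by linarith⟩
      · have h2 : τ j / Γ.len e ≤ t e := by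
          rw [div_le_iff₀ hle, mul_comm]
          simpa [τ, htg] using h1
        have h4 : x e = - (τ j / Γ.len e) := by simp [x, χ, hs, htg, neg_div]
        rw [h4]
        exact ⟨by linarith, by linarith [hte.2]⟩
    · rw [hx0 e hc, add_zero]
      exact hte
  refine ⟨j, hjG, hjX, ?_⟩
  have hsum : edgesClass q G t = edgeClass q j (t j + x j)
      + edgesClass q (G.erase j) (fun e => t e + x e) := by
    rw [← hclass]
    exact (Finset.add_sum_erase G (fun e => edgeClass q e (t e + x e)) hjG).symm
  have hrest : ∀ e ∈ G.erase j, t e + x e ∈ Icc (0 : ℝ) 1 :=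
    fun e he => hmem e (Finset.mem_of_mem_erase he)
  rcases (hcr j).1 hjX with ⟨hs, htg⟩ | ⟨hs, htg⟩
  · refine ⟨Γ.tgt j, htg, Or.inr rfl, _, hrest, ?_⟩
    have h1 : t j + x j = 1 := by
      have : x j = 1 - t j := by
        simp [x, χ, τ, hs, htg, (hl j).ne']
      linarith
    rw [hsum, h1, edgeClass_one]
  · refine ⟨Γ.src j, hs, Or.inl rfl, _, hrest, ?_⟩
    have h1 : t j + x j = 0 := by
      have : x j = - t j := by
        simp [x, χ, τ, hs, htg, (hl j).ne', neg_div]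
      linarith
    rw [hsum, h1, edgeClass_zero]

/-! ### Transport of a chip to a given vertex -/

/-- A chip at `w`, together with chips on a coconnected set `F`, can be brought to a given vertex
`p` within the divisor class, while the edges of a set `K` without chips stay available; unless it
arrives at a position where all the chips are on a larger coconnected set. -/
theorem exists_transport (q : Γ.Point) (K : Finset E) (p : V) (Y : Set V) :
    ∀ (F : Finset E) (t : E → ℝ) (w : V), Disjoint F K → Γ.IsCoconnected (F ∪ K) →
      (∀ e ∈ F, t e ∈ Icc (0 : ℝ) 1) → (w = p ∨ Γ.Separates F Y w p) →
      (∃ (F' : Finset E) (t' : E → ℝ), Disjoint F' K ∧ Γ.IsCoconnected (F' ∪ K) ∧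
        F'.card = F.card ∧ (∀ e ∈ F', t' e ∈ Icc (0 : ℝ) 1) ∧
        Γ.abelJacobi q (.vertex w) + edgesClass q F t
          = Γ.abelJacobi q (.vertex p) + edgesClass q F' t') ∨
      ∃ (F' : Finset E) (t' : E → ℝ), Γ.IsCoconnected F' ∧ F'.card = F.card + 1 ∧
        (∀ e ∈ F', t' e ∈ Icc (0 : ℝ) 1) ∧
        Γ.abelJacobi q (.vertex w) + edgesClass q F t = edgesClass q F' t' := by
  induction Y using WellFoundedLT.induction with
  | ind Y ih =>
  intro F t w hFK hF ht hw
  by_cases hwp : w = p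
  · subst hwp
    exact Or.inl ⟨F, t, hFK, hF, rfl, ht, rfl⟩
  have hY := hw.resolve_left hwp
  by_cases hmin : ∀ Y' ⊆ Y, Γ.Separates F Y' w p → Y' = Y
  swap
  · push Not at hmin
    obtain ⟨Y', hsub, hY', hne⟩ := hmin
    exact ih Y' (lt_of_le_of_ne hsub hne) F t w hFK hF ht (Or.inr hY')
  have hFc : Γ.IsCoconnected F := hF.mono Finset.subset_union_left
  obtain ⟨h, hhFK, hhY⟩ := hF Y ⟨p, hY.1⟩ fun h' => hY.2.1 (h' ▸ mem_univ w)
  have hhF : h ∉ F := fun h' => hhFK (Finset.mem_union_left _ h')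
  have hhK : h ∉ K := fun h' => hhFK (Finset.mem_union_right _ h')
  obtain ⟨s, hs, hsw⟩ := exists_edgeClass_eq q (hY.2.2 h hhF hhY)
  have ht' := update_mem_Icc ht hs (h := h)
  have hcl := edgesClass_insert q (t := t) hhF s
  rw [hsw] at hcl
  by_cases hun : ∃ h' ∉ F, Γ.Crosses Y h' ∧ h' ≠ h
  · obtain ⟨h', hh', hhY', hne⟩ := hun
    exact Or.inr ⟨insert h F, _, hFc.insert_of_minimal hY hmin hhF hhY hh' hhY' hne,
      Finset.card_insert_of_notMem hhF, ht', hcl.symm⟩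
  push Not at hun
  have hYG : ∀ e, Γ.Crosses Y e → e ∈ insert h F := fun e he => by
    by_cases heF : e ∈ F
    · exact Finset.mem_insert_of_mem heF
    · rw [hun e heF he]
      exact Finset.mem_insert_self h F
  obtain ⟨j, hjG, hjY, w', hw'Y, hjw', t', ht'', hcl'⟩ :=
    exists_move_into_cut q ht' hYG ⟨h, hhY⟩
  have hF'K : Disjoint ((insert h F).erase j) K := by
    refine Finset.disjoint_of_subset_left (Finset.erase_subset _ _) ?_
    exact Finset.disjoint_insert_left.2 ⟨hhK, hFK⟩
  have hF' : Γ.IsCoconnected ((insert h F).erase j ∪ K) := by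
    refine hF.exchange (X := Y) (h := h)
      (fun e hc he => hun e (fun h' => he (Finset.mem_union_left _ h')) hc) hjY fun e he => ?_
    have hjK : j ∉ K := fun h' => by
      rcases Finset.mem_insert.1 hjG with rfl | hjF
      · exact hhK h'
      · exact Finset.disjoint_left.1 hFK hjF h'
    rcases Finset.mem_union.1 he with he | he
    · obtain ⟨h1, h2⟩ := Finset.mem_erase.1 he
      exact ⟨(Finset.mem_insert.1 h2).symm.imp_left (Finset.mem_union_left _), h1⟩
    · exact ⟨Or.inl (Finset.mem_union_right _ he), fun h' => hjK (h' ▸ he)⟩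
  have hcard : ((insert h F).erase j).card = F.card := by
    rw [Finset.card_erase_of_mem hjG, Finset.card_insert_of_notMem hhF, Nat.add_sub_cancel]
  have hlt : Y \ {w'} < Y := sdiff_singleton_ssubset.2 hw'Y
  have hsep : w' = p ∨ Γ.Separates ((insert h F).erase j) (Y \ {w'}) w' p := by
    refine or_iff_not_imp_left.2 fun hne => ⟨⟨hY.1, fun h' => hne h'.symm⟩, fun h' => h'.2 rfl, ?_⟩
    intro e he hc
    by_cases hcY : Γ.Crosses Y e
    · have hej : e = j := by
        by_contra hej
        exact he (Finset.mem_erase.2 ⟨hej, hYG e hcY⟩)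
      rwa [hej]
    · simp only [Crosses, Set.mem_sdiff, mem_singleton_iff] at hc hcY
      clear * - hc hcY
      tauto
  rcases ih _ hlt _ t' w' hF'K hF' ht'' hsep with
    ⟨F'', t'', h1, h2, h3, h4, h5⟩ | ⟨F'', t'', h1, h2, h3, h4⟩
  · exact Or.inl ⟨F'', t'', h1, h2, h3.trans hcard, h4, by rw [← hcl, hcl', h5]⟩
  · exact Or.inr ⟨F'', t'', h1, h2.trans (by rw [hcard]), h3, by rw [← hcl, hcl', h4]⟩

/-- A chip at an arbitrary point, together with chips on a coconnected set `F`, can be brought to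
some vertex within the divisor class, unless all the chips are on a larger coconnected set. -/
theorem IsCoconnected.exists_vertex (q x : Γ.Point) {F : Finset E} (hF : Γ.IsCoconnected F)
    {t : E → ℝ} (ht : ∀ e ∈ F, t e ∈ Icc (0 : ℝ) 1) :
    (∃ (F' : Finset E) (t' : E → ℝ) (w : V), Γ.IsCoconnected F' ∧ F'.card = F.card ∧
      (∀ e ∈ F', t' e ∈ Icc (0 : ℝ) 1) ∧
      Γ.abelJacobi q x + edgesClass q F t
        = Γ.abelJacobi q (.vertex w) + edgesClass q F' t') ∨
    ∃ (F' : Finset E) (t' : E → ℝ), Γ.IsCoconnected F' ∧ F'.card = F.card + 1 ∧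
      (∀ e ∈ F', t' e ∈ Icc (0 : ℝ) 1) ∧
      Γ.abelJacobi q x + edgesClass q F t = edgesClass q F' t' := by
  cases x with
  | vertex v => exact Or.inl ⟨F, t, v, hF, rfl, ht, rfl⟩
  | inner e y h0 h1 =>
    rw [abelJacobi_inner]
    set s := y / Γ.len e
    have hs : s ∈ Icc (0 : ℝ) 1 :=
      ⟨div_nonneg h0.le (Γ.len_pos e).le, (div_le_one (Γ.len_pos e)).2 h1.le⟩
    by_cases heF : e ∈ F
    · -- Two chips on the same edge can be moved apart until one of them arrives at an end.
      left
      have hte := ht e heF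
      have key : ∀ (s' : ℝ) (v : V), s' ∈ Icc (0 : ℝ) 1 →
          edgeClass q e s + edgeClass q e (t e)
            = Γ.abelJacobi q (.vertex v) + edgeClass q e s' →
          ∃ (F' : Finset E) (t' : E → ℝ) (w : V), Γ.IsCoconnected F' ∧ F'.card = F.card ∧
            (∀ e ∈ F', t' e ∈ Icc (0 : ℝ) 1) ∧ edgeClass q e s + edgesClass q F t
              = Γ.abelJacobi q (.vertex w) + edgesClass q F' t' := by
        intro s' v hs' hv
        refine ⟨F, Function.update t e s', v, hF, rfl, fun e' he' =>
          update_mem_Icc ht hs' e' (Finset.mem_insert_of_mem he'), ?_⟩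
        have h2 := edgesClass_insert q (t := t) (Finset.notMem_erase e F) s'
        rw [Finset.insert_erase heF] at h2
        rw [h2, ← add_assoc, ← hv, edgesClass, ← Finset.add_sum_erase F _ heF, ← add_assoc]
        rfl
      have h2 : edgeClass q e s + edgeClass q e (t e)
          = edgeClass q e 0 + edgeClass q e (s + t e) := by
        rw [add_comm s, edgeClass_add, edgeClass_zero, edgeClass]
        abel
      by_cases hst : s + t e ≤ 1
      · exact key _ _ ⟨add_nonneg hs.1 hte.1, hst⟩ (by rw [h2, edgeClass_zero])
      · refine key (s + t e - 1) (Γ.tgt e) ⟨by linarith, by linarith [hs.2, hte.2]⟩ ?_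
        have h3 := edgeClass_add q e (s + t e - 1) 1
        rw [sub_add_cancel] at h3
        rw [h2, h3, ← edgeClass_one, ← zero_add (1 : ℝ), edgeClass_add, zero_add]
        abel
    · have ht' := update_mem_Icc ht hs (h := e)
      have hcl := edgesClass_insert q (t := t) heF s
      by_cases hFe : Γ.IsCoconnected (insert e F)
      · exact Or.inr ⟨_, _, hFe, Finset.card_insert_of_notMem heF, ht', hcl.symm⟩
      · left
        simp only [IsCoconnected, not_forall, not_exists, not_and] at hFe
        obtain ⟨X, hX, hX', hcr⟩ := hFe
        have hXG : ∀ e', Γ.Crosses X e' → e' ∈ insert e F := fun e' hc => by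
          by_contra h'
          exact hcr e' h' hc
        obtain ⟨e', he', hc'⟩ := hF X hX hX'
        obtain ⟨j, hjG, hjX, w, -, -, t', ht'', hcl'⟩ :=
          exists_move_into_cut q ht' hXG ⟨e', hc'⟩
        refine ⟨(insert e F).erase j, t', w, ?_, ?_, ht'', by rw [← hcl, hcl']⟩
        · refine hF.exchange (X := X) (h := e) (fun e' hc he' =>
            (Finset.mem_insert.1 (hXG e' hc)).resolve_right he') hjX fun e' he' => ?_
          obtain ⟨h1, h2⟩ := Finset.mem_erase.1 he'
          exact ⟨(Finset.mem_insert.1 h2).symm, h1⟩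
        · rw [Finset.card_erase_of_mem hjG, Finset.card_insert_of_notMem heF, Nat.add_sub_cancel]

end ChipMoves

/-! ### The topology of the Jacobian and of `Pic^d` -/

section EffectiveClasses

variable {V E : Type*} {Γ : MetricGraph V E} [Fintype E] [DecidableEq V]

theorem continuous_chainClass : Continuous Γ.chainClass :=
  continuous_quotient_mk'.comp Γ.cycleProj.continuous_of_finiteDimensional

theorem isClosed_H1Int : IsClosed (Γ.H1Int : Set Γ.H1) := by
  have : (Γ.H1Int : Set Γ.H1) = ⋂ e, (fun c : Γ.H1 => c.1 e) ⁻¹' range ((↑) : ℤ → ℝ) := by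
    ext c
    simp only [mem_iInter, mem_preimage, mem_range]
    exact forall_congr' fun e => exists_congr fun n => eq_comm
  rw [this]
  exact isClosed_iInter fun e =>
    Int.isClosedEmbedding_coe_real.isClosed_range.preimage
      ((continuous_apply e).comp continuous_subtype_val)

instance : T2Space Γ.Jac :=
  have : IsClosed (Γ.H1Int : Set Γ.H1) := isClosed_H1Int
  inferInstance

variable [DecidableEq E]

/-- An open set of classes is described by an open subset of the Jacobian. -/
theorem exists_isOpen_of_isOpen_pic (q : Γ.Point) (d : ℤ) {O : Set (Γ.Pic d)}
    (hO : IsOpen[Γ.picTopology q d] O) :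
    ∃ N : Set Γ.Jac, IsOpen N ∧ ∀ D : Γ.DivDeg d, Γ.picMk d D ∈ O ↔ ajHom q D.1 ∈ N := by
  obtain ⟨N, hN, h⟩ := isOpen_coinduced.1 hO
  exact ⟨N, hN, fun D => (Set.ext_iff.1 h D).symm⟩

/-! ### Classes of effective divisors in the Jacobian -/

/-- The image in the Jacobian of the effective divisors of degree `k`. -/
def effectiveClasses (q : Γ.Point) (k : ℤ) : Set Γ.Jac :=
  {y | ∃ D : Γ.Divisor, D.IsEffective ∧ D.degree = k ∧ ajHom q D = y}

theorem edgesClass_mem_effectiveClasses (q : Γ.Point) {F : Finset E} {t : E → ℝ}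
    (ht : ∀ e ∈ F, t e ∈ Icc (0 : ℝ) 1) :
    edgesClass q F t ∈ effectiveClasses q F.card :=
  ⟨Γ.edgeDivisor F t, edgeDivisor_isEffective F t, edgeDivisor_degree F t, ajHom_edgeDivisor q ht⟩

theorem effectiveClasses_of_neg (q : Γ.Point) {k : ℤ} (hk : k < 0) :
    effectiveClasses q k = ∅ := by
  refine eq_empty_of_forall_notMem ?_
  rintro _ ⟨D, hD, hdeg, -⟩
  have := hD.degree_nonneg
  lia

open scoped Pointwise in
theorem effectiveClasses_succ (q : Γ.Point) (k : ℕ) :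
    effectiveClasses q ((k + 1 : ℕ) : ℤ) = effectiveClasses q k + range (Γ.abelJacobi q) := by
  ext y
  constructor
  · rintro ⟨D, hD, hdeg, rfl⟩
    obtain ⟨p, D', hD', rfl⟩ := hD.exists_eq_add (by rw [hdeg]; positivity)
    rw [degree_add, degree_single] at hdeg
    refine mem_add.2 ⟨_, ⟨D', hD', by push_cast at hdeg; lia, rfl⟩, _, ⟨p, rfl⟩, ?_⟩
    rw [map_add, ajHom_single, one_smul]
  · rintro ⟨_, ⟨D, hD, hdeg, rfl⟩, _, ⟨p, rfl⟩, rfl⟩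
    refine ⟨D + Finsupp.single p 1, hD.add (isEffective_single p zero_le_one), ?_, ?_⟩
    · rw [degree_add, degree_single, hdeg]
      push_cast
      rfl
    · rw [map_add, ajHom_single, one_smul]

theorem continuous_edgeClass (q : Γ.Point) (e : E) : Continuous (edgeClass q e) :=
  continuous_const.add (continuous_chainClass.comp (continuous_single e))

/-- Chips on closed edges can be moved into the interiors of the edges by arbitrarily small
changes of the class. -/
theorem exists_edgesClass_mem (q : Γ.Point) {F : Finset E} {t : E → ℝ}
    (ht : ∀ e ∈ F, t e ∈ Icc (0 : ℝ) 1) {N : Set Γ.Jac} (hN : IsOpen N)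
    (hmem : edgesClass q F t ∈ N) :
    ∃ t' : E → ℝ, (∀ e ∈ F, t' e ∈ Ioo (0 : ℝ) 1) ∧ edgesClass q F t' ∈ N := by
  let γ : ℝ → E → ℝ := fun ε e => t e + ε * (1 / 2 - t e)
  have hcont : Continuous fun ε => edgesClass q F (γ ε) :=
    continuous_finsetSum _ fun e _ => (continuous_edgeClass q e).comp (by fun_prop)
  have h0 : edgesClass q F (γ 0) ∈ N := by simpa [γ] using hmem
  have hev : ∀ᶠ ε in 𝓝[>] (0 : ℝ), edgesClass q F (γ ε) ∈ N :=
    (hcont.continuousAt.eventually (hN.mem_nhds h0)).filter_mono nhdsWithin_le_nhds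
  obtain ⟨ε, hε, hε'⟩ := (hev.and (Ioo_mem_nhdsGT (zero_lt_one (α := ℝ)))).exists
  refine ⟨γ ε, fun e he => ?_, hε⟩
  have hte := ht e he
  simp only [γ]
  constructor <;> nlinarith [hte.1, hte.2, hε'.1, hε'.2]

variable [Fintype V]

theorem isCompact_range_abelJacobi (q : Γ.Point) : IsCompact (range (Γ.abelJacobi q)) := by
  have : range (Γ.abelJacobi q) = (⋃ v, {Γ.abelJacobi q (.vertex v)})
      ∪ ⋃ e, edgeClass q e '' Icc 0 1 := by
    ext y
    constructor
    · rintro ⟨p, rfl⟩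
      cases p with
      | vertex v => exact Or.inl (mem_iUnion.2 ⟨v, rfl⟩)
      | inner e t h0 h1 =>
        exact Or.inr (mem_iUnion.2 ⟨e, t / Γ.len e, ⟨div_nonneg h0.le (Γ.len_pos e).le,
          (div_le_one (Γ.len_pos e)).2 h1.le⟩, (abelJacobi_inner q e t h0 h1).symm⟩)
    · rintro (h | h)
      · obtain ⟨v, rfl⟩ := mem_iUnion.1 h
        exact ⟨_, rfl⟩
      · obtain ⟨e, s, hs, rfl⟩ := mem_iUnion.1 h
        exact ⟨_, abelJacobi_edgePoint q e hs⟩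
  rw [this]
  exact (isCompact_iUnion fun _ => isCompact_singleton).union
    (isCompact_iUnion fun e => isCompact_Icc.image (continuous_edgeClass q e))

theorem isCompact_effectiveClasses (q : Γ.Point) (k : ℕ) :
    IsCompact (effectiveClasses q (k : ℤ)) := by
  induction k with
  | zero =>
    have : effectiveClasses q ((0 : ℕ) : ℤ) = {0} := by
      ext y
      constructor
      · rintro ⟨D, hD, hdeg, rfl⟩
        rw [hD.eq_zero hdeg]
        simp
      · rintro rfl
        exact ⟨0, isEffective_zero, by simp [Divisor.degree], map_zero _⟩
    rw [this]
    exact isCompact_singleton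
  | succ k ih =>
    rw [effectiveClasses_succ]
    exact ih.add (isCompact_range_abelJacobi q)

theorem isClosed_effectiveClasses (q : Γ.Point) (k : ℤ) : IsClosed (effectiveClasses q k) := by
  rcases lt_or_ge k 0 with hk | hk
  · rw [effectiveClasses_of_neg q hk]
    exact isClosed_empty
  · lift k to ℕ using hk
    exact (isCompact_effectiveClasses q k).isClosed

/-- Every effective divisor class of degree at most `g` is represented by chips on the closed edges
of a coconnected set, one on each. -/
theorem exists_edgesClass_eq (q : Γ.Point) {d : ℕ} (hd : d ≤ Γ.genus) {y : Γ.Jac}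
    (hy : y ∈ effectiveClasses q d) :
    ∃ (F : Finset E) (t : E → ℝ), Γ.IsCoconnected F ∧ F.card = d ∧
      (∀ e ∈ F, t e ∈ Icc (0 : ℝ) 1) ∧ y = edgesClass q F t := by
  induction d generalizing y with
  | zero =>
    obtain ⟨D, hD, hdeg, rfl⟩ := hy
    rw [hD.eq_zero hdeg]
    exact ⟨∅, 0, isCoconnected_empty, rfl, by simp, by simp [edgesClass]⟩
  | succ d ih =>
    rw [effectiveClasses_succ] at hy
    obtain ⟨y', hy', _, ⟨x, rfl⟩, rfl⟩ := hy
    obtain ⟨F, t, hF, hcard, ht, rfl⟩ := ih (by lia) hy'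
    beta_reduce
    rw [add_comm (edgesClass q F t)]
    rcases hF.exists_vertex q x ht with
      ⟨F₁, t₁, w, hF₁, hc₁, ht₁, heq⟩ | ⟨F₁, t₁, hF₁, hc₁, ht₁, heq⟩
    swap
    · exact ⟨F₁, t₁, hF₁, by lia, ht₁, heq⟩
    rw [heq]
    -- The chip at `w` is brought to an end of an edge `c` that can be added to the set.
    obtain ⟨c, hc, hFc⟩ := hF₁.exists_insert (by lia)
    have hw : w = Γ.src c ∨ Γ.Separates F₁ {w}ᶜ w (Γ.src c) :=
      or_iff_not_imp_left.2 separates_compl_singleton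
    rw [Finset.insert_eq, Finset.union_comm] at hFc
    rcases exists_transport q {c} (Γ.src c) {w}ᶜ F₁ t₁ w
      (Finset.disjoint_singleton_right.2 hc) hFc ht₁ hw with
      ⟨F₂, t₂, hdis, hF₂, hc₂, ht₂, heq₂⟩ | ⟨F₂, t₂, hF₂, hc₂, ht₂, heq₂⟩
    · have hc₃ : c ∉ F₂ := Finset.disjoint_singleton_right.1 hdis
      rw [Finset.union_comm, ← Finset.insert_eq] at hF₂
      refine ⟨insert c F₂, Function.update t₂ c 0, hF₂, ?_,
        update_mem_Icc ht₂ (by simp), ?_⟩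
      · rw [Finset.card_insert_of_notMem hc₃]
        lia
      · rw [edgesClass_insert q hc₃, edgeClass_zero, heq₂]
    · exact ⟨F₂, t₂, hF₂, by lia, ht₂, heq₂⟩

/-- An effective divisor of degree `g + 1` remains equivalent to an effective divisor when a vertex
is subtracted from it. -/
theorem add_sub_mem_effectiveClasses (q : Γ.Point) {y : Γ.Jac}
    (hy : y ∈ effectiveClasses q Γ.genus) (x : Γ.Point) (p : V) :
    y + (Γ.abelJacobi q x - Γ.abelJacobi q (.vertex p)) ∈ effectiveClasses q Γ.genus := by
  obtain ⟨F, t, hF, hcard, ht, rfl⟩ := exists_edgesClass_eq q le_rfl hy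
  rcases hF.exists_vertex q x ht with
    ⟨F₁, t₁, w, hF₁, hc₁, ht₁, heq⟩ | ⟨F₁, t₁, hF₁, hc₁, -, -⟩
  swap
  · have := hF₁.card_le_genus
    lia
  have hw : w = p ∨ Γ.Separates F₁ {w}ᶜ w p := or_iff_not_imp_left.2 separates_compl_singleton
  rcases exists_transport q ∅ p {w}ᶜ F₁ t₁ w (by simp) (by simpa using hF₁) ht₁ hw with
    ⟨F₂, t₂, -, -, hc₂, ht₂, heq₂⟩ | ⟨F₂, t₂, hF₂, hc₂, -, -⟩
  · have h := edgesClass_mem_effectiveClasses q ht₂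
    rw [hc₂, hc₁, hcard] at h
    convert h using 1
    rw [← add_sub_assoc, add_comm, heq, heq₂, add_sub_cancel_left]
  · have := hF₂.card_le_genus
    lia

/-- Every divisor class of degree `g` is effective: the effective classes are stable under
translation by small multiples of the projections of the edges, in both directions, and these
generate the Jacobian. -/
theorem effectiveClasses_genus (q : Γ.Point) : effectiveClasses q Γ.genus = univ := by
  have hsmall : ∀ (e : E) (s : ℝ), |s| ≤ 1 → ∀ y ∈ effectiveClasses q Γ.genus,
      y + Γ.chainClass (Pi.single e s) ∈ effectiveClasses q Γ.genus := by
    intro e s hs y hy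
    rw [abs_le] at hs
    rcases le_total 0 s with h0 | h0
    · have h := add_sub_mem_effectiveClasses q hy (Γ.edgePoint e (s * Γ.len e)) (Γ.src e)
      rwa [abelJacobi_edgePoint q e ⟨h0, hs.2⟩, edgeClass, add_sub_cancel_left] at h
    · have h := add_sub_mem_effectiveClasses q hy (Γ.edgePoint e ((1 + s) * Γ.len e)) (Γ.tgt e)
      rwa [abelJacobi_edgePoint q e ⟨by linarith, by linarith⟩, edgeClass_add, edgeClass_one,
        add_sub_cancel_left] at h
  have hmul : ∀ (c : E → ℝ) (n : ℕ), (∀ y ∈ effectiveClasses q Γ.genus,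
      y + Γ.chainClass c ∈ effectiveClasses q Γ.genus) → ∀ y ∈ effectiveClasses q Γ.genus,
      y + Γ.chainClass (n • c) ∈ effectiveClasses q Γ.genus := by
    intro c n hc y hy
    induction n with
    | zero => simpa using hy
    | succ n ih => rw [succ_nsmul, map_add, ← add_assoc]; exact hc _ ih
  have hedge : ∀ (e : E) (s : ℝ), ∀ y ∈ effectiveClasses q Γ.genus,
      y + Γ.chainClass (Pi.single e s) ∈ effectiveClasses q Γ.genus := by
    intro e s
    obtain ⟨n, hn⟩ := exists_nat_gt |s|
    have hn0 : (0 : ℝ) < n := (abs_nonneg s).trans_lt hn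
    have h := hmul (Pi.single e (s / n)) n (hsmall e (s / n) (by
      rw [abs_div, Nat.abs_cast]
      exact (div_le_one hn0).2 hn.le))
    rwa [← Pi.single_smul, nsmul_eq_mul, mul_div_cancel₀ _ hn0.ne'] at h
  have hall : ∀ (c : E → ℝ) (S : Finset E), ∀ y ∈ effectiveClasses q Γ.genus,
      y + Γ.chainClass (∑ e ∈ S, Pi.single e (c e)) ∈ effectiveClasses q Γ.genus := by
    intro c S
    induction S using Finset.induction_on with
    | empty => intro y hy; simpa using hy
    | insert e S he ih =>
      intro y hy
      rw [Finset.sum_insert he, map_add, ← add_assoc]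
      exact ih _ (hedge e _ y hy)
  obtain ⟨v⟩ := Γ.nonempty
  have h0 : ajHom q (Finsupp.single (.vertex v) (Γ.genus : ℤ)) ∈ effectiveClasses q Γ.genus :=
    ⟨_, isEffective_single _ (by positivity), degree_single _ _, rfl⟩
  refine eq_univ_of_forall fun z => ?_
  obtain ⟨ω, hω⟩ := QuotientAddGroup.mk_surjective
    (z - ajHom q (Finsupp.single (.vertex v) (Γ.genus : ℤ)))
  have h1 : Γ.chainClass ω.1 = QuotientAddGroup.mk ω := by
    change QuotientAddGroup.mk (Γ.cycleProj ω.1) = _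
    rw [cycleProj_coe]
  have h2 := hall ω.1 Finset.univ _ h0
  rwa [Finset.univ_sum_single, h1, hω, add_sub_cancel] at h2

/-! ### The open dense set of classes of generic rank -/

/-- The map `Pic^d(Γ) → Jac(Γ)` induced by the Abel-Jacobi map. -/
def picClass (q : Γ.Point) (d : ℤ) : Γ.Pic d → Γ.Jac :=
  Quotient.lift (s := Γ.linSetoid d) (Γ.abelJacobiDiv q d) fun _ _ h =>
    Divisor.LinEquiv.ajHom_eq h q

theorem picClass_picMk (q : Γ.Point) (d : ℤ) (D : Γ.DivDeg d) :
    picClass q d (Γ.picMk d D) = ajHom q D.1 := rfl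

theorem isOpen_picClass_preimage (q : Γ.Point) (d : ℤ) {N : Set Γ.Jac} (hN : IsOpen N) :
    IsOpen[Γ.picTopology q d] (picClass q d ⁻¹' N) :=
  isOpen_coinduced.2 ⟨N, hN, rfl⟩

theorem linearSystem_nonempty_iff (q : Γ.Point) (D : Γ.Divisor) :
    D.linearSystem.Nonempty ↔ ajHom q D ∈ effectiveClasses q D.degree := by
  constructor
  · rintro ⟨D', hD', h⟩
    exact ⟨D', hD', h.degree_eq, h.ajHom_eq q⟩
  · rintro ⟨D', hD', hdeg, h⟩
    exact ⟨D', hD', linEquiv_of_ajHom_eq hdeg q h⟩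

end EffectiveClasses

end

end MetricGraph

open MetricGraph

theorem theorem7p4 {V E : Type*} [Fintype V] [Fintype E] [DecidableEq V] [DecidableEq E]
    (Γ : MetricGraph V E) (q : Γ.Point) (d : ℕ) :
    letI : TopologicalSpace (Γ.Pic d) := Γ.picTopology q d
    ∃ U : Set (Γ.effectiveLocus d), IsOpen U ∧ Dense U ∧
      ∀ (D : Γ.DivDeg d) (hD : Γ.picMk d D ∈ Γ.effectiveLocus d),
        (⟨Γ.picMk d D, hD⟩ : Γ.effectiveLocus d) ∈ U →
          D.1.HasRank (if Γ.genus < d then (d : ℤ) - (Γ.genus : ℤ) else 0) := by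
  let _ : TopologicalSpace (Γ.Pic d) := Γ.picTopology q d
  obtain ⟨v⟩ := Γ.nonempty
  set g := Γ.genus with hg
  let k : ℕ := d - g
  let V₀ : ℤ → Γ.Divisor := fun n => Finsupp.single (.vertex v) n
  let N₀ : Set Γ.Jac := {y | y - ajHom q (V₀ (k + 1)) ∈ effectiveClasses q (d - k - 1)}ᶜ
  have hN₀ : IsOpen N₀ := by
    refine IsClosed.isOpen_compl (self := ?_)
    exact (isClosed_effectiveClasses q _).preimage (continuous_id.sub continuous_const)
  refine ⟨Subtype.val ⁻¹' (picClass q d ⁻¹' N₀), ⟨_, isOpen_picClass_preimage q d hN₀, rfl⟩,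
    ?_, ?_⟩
  · rw [dense_iff_inter_open]
    rintro _ ⟨O, hO, rfl⟩ ⟨⟨c, D, hD, rfl⟩, hc⟩
    obtain ⟨N, hN, hON⟩ := exists_isOpen_of_isOpen_pic q d hO
    have hDN : ajHom q D.1 ∈ N := (hON D).1 hc
    -- If `d > g`, then every class of degree `d - k = g` is effective.
    have hmem : ajHom q D.1 - ajHom q (V₀ k) ∈ effectiveClasses q ((d - k : ℕ) : ℤ) := by
      by_cases hdg : g ≤ d
      · have : d - k = g := by lia
        rw [this, hg, effectiveClasses_genus]
        trivial
      · have hk : k = 0 := by lia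
        have h0 : ajHom q D.1 ∈ effectiveClasses q (d : ℤ) := ⟨D.1, hD, D.2, rfl⟩
        rw [hk]
        simpa [V₀] using h0
    obtain ⟨F, t, hF, hcard, ht, heq⟩ := exists_edgesClass_eq q (by lia) hmem
    obtain ⟨t', ht', hN'⟩ := exists_edgesClass_mem q ht
      (hN.preimage (continuous_add_const (ajHom q (V₀ k)))) (by
        rw [← heq, mem_preimage, sub_add_cancel]
        exact hDN)
    rw [mem_preimage, ← ajHom_edgeDivisor q fun e he => Ioo_subset_Icc_self (ht' e he),
      ← map_add] at hN'
    have heff : Divisor.IsEffective (Γ.edgeDivisor F t' + V₀ k) :=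
      (edgeDivisor_isEffective F t').add (isEffective_single _ (by positivity))
    have hdeg : Divisor.degree (Γ.edgeDivisor F t' + V₀ k) = d := by
      rw [degree_add, edgeDivisor_degree, degree_single, hcard]
      lia
    let D' : Γ.DivDeg d := ⟨Γ.edgeDivisor F t' + V₀ k, hdeg⟩
    refine ⟨⟨Γ.picMk d D', D', heff, rfl⟩, (hON D').2 hN', ?_⟩
    rintro ⟨B, hB, hBdeg, hBaj⟩
    have hB' : Divisor.LinEquiv (B + V₀ 1) (Γ.edgeDivisor F t') := by
      refine linEquiv_of_ajHom_eq ?_ q ?_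
      · rw [degree_add, hBdeg, degree_single, edgeDivisor_degree, hcard]
        lia
      · rw [map_add, hBaj, picClass_picMk, ← map_sub, ← map_add]
        congr 1
        simp only [D', V₀, Finsupp.single_add]
        abel
    have h0 := hF.apply_vertex_eq_zero_of_linEquiv ht'
      (hB.add (isEffective_single _ zero_le_one)) hB' v
    have h1 := hB (.vertex v)
    rw [Finsupp.add_apply, Finsupp.single_eq_same] at h0
    lia
  · intro D hD hU
    have hr : (if g < d then (d : ℤ) - (g : ℤ) else 0) = k := by
      split_ifs <;> lia
    rw [hr]
    constructor
    · refine Or.inr ⟨by positivity, fun B hB hBdeg => ?_⟩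
      rw [linearSystem_nonempty_iff q, degree_sub, D.2, hBdeg]
      by_cases hdg : g ≤ d
      · have : (d : ℤ) - k = g := by lia
        rw [this, hg, effectiveClasses_genus]
        trivial
      · have hk : k = 0 := by lia
        rw [hk] at hBdeg ⊢
        rw [hB.eq_zero hBdeg, sub_zero]
        obtain ⟨D', hD', heq⟩ := hD
        exact ⟨D'.1, hD', by rw [D'.2]; simp, (Quotient.exact heq : D'.1.LinEquiv D.1).ajHom_eq q⟩
    · rintro s (rfl | ⟨hs, hE⟩)
      · lia
      by_contra hks
      push Not at hks
      obtain ⟨B, hB, hlin⟩ := hE (V₀ s) (isEffective_single _ hs) (degree_single _ _)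
      refine hU ⟨B + V₀ (s - k - 1), hB.add (isEffective_single _ (by lia)), ?_, ?_⟩
      · rw [degree_add, hlin.degree_eq, degree_sub, D.2, degree_single, degree_single]
        ring
      · rw [map_add, hlin.ajHom_eq q, picClass_picMk, ← map_sub, ← map_add]
        congr 1
        have : V₀ s = V₀ (s - k - 1) + V₀ (k + 1) := by
          simp only [V₀, ← Finsupp.single_add]
          congr 1
          ring
        rw [this]
        abel
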